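/- All representations and sheaves are over $\mathbb C$. An $\ell$-space is a Hausdorff, locally compact, totally disconnected, second countable topological space; an $\ell$-group is a topological group whose underlying space is an $\ell$-space. Let $G$ be an $\ell$-group acting continuously on an $\ell$-space $X$. A $G$-equivariant $\ell$-sheaf on $X$ is a sheaf $\mathcal F$ of complex vector spaces on $X$ together with a continuous action of $G$ on its étalé space $\bigsqcup_{x\in X}\mathcal F_x$ such that each $g\in G$ restricts to linear maps $\mathcal F_x\to\mathcal F_{g.x}$ for all $x\in X$. For a $G$-stable locally closed subset $Z\subset X$, the space $\Gamma_c(\mathcal F|_Z)$ of compactly supported sections of $\mathcal F|_Z$ is a smooth representation of $G$ by $(g.s)_{g.z}=g.s_z$. Let $\mathcal M(G)$ be the abelian category of smooth representations of $G$ (those in which every vector is fixed by an open subgroup), let $\operatorname{Ext}^i_G$ denote its Ext groups (zero for $i<0$), and let $V^\vee$ denote the smooth contragredient of $V$. For smooth representations $V,W$ and $k\in\mathbb N=\{0,1,2,\dots\}$, let $$\operatorname{Hom}_{G,k}(V,W)=\{\phi\in\operatorname{Hom}_{\mathbb C}(V,W)\mid (g_0-1)(g_1-1)\cdots(g_k-1).\phi=0\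 \text{ for all } g_0,\dots,g_k\in G\},$$ where $(g.\phi)(v)=g.(\phi(g^{-1}.v))$, and let $\operatorname{Ext}^i_{G,k}(V,W)$ be the $i$-th cohomology of $\operatorname{Hom}_{G,k}(V,I^\bullet)$ for an injective resolution $W\to I^\bullet$ in $\mathcal M(G)$ (zero for $i<0$). Theorem. Let $\mathcal F$ be a $G$-equivariant $\ell$-sheaf on $X$, let $Y$ be an $\ell$-space, and let $\pi:X\to Y$ be a continuous map with $\pi(g.x)=\pi(x)$ for all $g\in G$, $x\in X$. For $y\in Y$ put $X_y=\pi^{-1}(y)$. (1) Let $V_1,V_2$ be smooth representations of $G$ and let $i\in\mathbb Z$. If $$\operatorname{Ext}^i_G(\Gamma_c(\mathcal F|_{X_y})\otimes V_1,V_2^\vee)=0\quad\text{for all } y\in Y,$$ then $\operatorname{Ext}^i_G(\Gamma_c(\mathcal F)\otimes V_1,V_2^\vee)=0$. (2) Let $\chi:G\to\mathbb C^\times$ be a locally constant character, let $k\in\mathbb N$ and let $i\in\mathbb Z$. If $$\operatorname{Ext}^i_{G,k}(\Gamma_c(\mathcal F|_{X_y}),\chi)=0\quad\text{for all } y\in Y,$$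 then $\operatorname{Ext}^i_{G,k}(\Gamma_c(\mathcal F),\chi)=0$. -/

import Mathlib

universe u

open CategoryTheory TopologicalSpace

namespace LSheaf

/-- An `ℓ`-space: Hausdorff, locally compact, totally disconnected and second countable. -/
class IsLSpace (X : Type*) [TopologicalSpace X] : Prop extends
  T2Space X, LocallyCompactSpace X, TotallyDisconnectedSpace X, SecondCountableTopology X

section Smooth

variable {G : Type u} [Group G] [TopologicalSpace G]
variable {V : Type u} [AddCommGroup V] [Module ℂ V]
variable {W : Type u} [AddCommGroup W] [Module ℂ W]

/-- A vector is smooth if it is fixed by an open subgroup. -/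
def IsSmoothVector (ρ : Representation ℂ G V) (v : V) : Prop :=
  ∃ U : Subgroup G, IsOpen (U : Set G) ∧ ∀ g ∈ U, ρ g v = v

/-- A representation is smooth if all its vectors are smooth. -/
def IsSmooth (ρ : Representation ℂ G V) : Prop := ∀ v, IsSmoothVector ρ v

lemma isSmoothVector_zero (ρ : Representation ℂ G V) : IsSmoothVector ρ 0 :=
  ⟨⊤, isOpen_univ, fun g _ => map_zero (ρ g)⟩

lemma IsSmoothVector.add {ρ : Representation ℂ G V} {v w : V}
    (hv : IsSmoothVector ρ v) (hw : IsSmoothVector ρ w) : IsSmoothVector ρ (v + w) := by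
  obtain ⟨A, hA, hA'⟩ := hv
  obtain ⟨B, hB, hB'⟩ := hw
  exact ⟨A ⊓ B, hA.inter hB, fun g hg => by rw [map_add, hA' g hg.1, hB' g hg.2]⟩

lemma IsSmoothVector.map {ρ : Representation ℂ G V} {σ : Representation ℂ G W}
    (f : ρ.IntertwiningMap σ) {v : V} (hv : IsSmoothVector ρ v) : IsSmoothVector σ (f v) := by
  obtain ⟨A, hA, hA'⟩ := hv
  exact ⟨A, hA, fun g hg => by rw [← f.isIntertwining, hA' g hg]⟩

lemma IsSmoothVector.smul {ρ : Representation ℂ G V} {v : V} (c : ℂ)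
    (hv : IsSmoothVector ρ v) : IsSmoothVector ρ (c • v) := by
  obtain ⟨A, hA, hA'⟩ := hv
  exact ⟨A, hA, fun g hg => by rw [map_smul, hA' g hg]⟩

/-- The tensor product (with diagonal action) of smooth representations is smooth. -/
lemma IsSmooth.tprod {ρ : Representation ℂ G V} {σ : Representation ℂ G W}
    (hρ : IsSmooth ρ) (hσ : IsSmooth σ) : IsSmooth (ρ.tprod σ) := by
  intro t
  induction t using TensorProduct.induction_on with
  | zero => exact isSmoothVector_zero _
  | tmul v w =>
    obtain ⟨A, hA, hA'⟩ := hρ v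
    obtain ⟨B, hB, hB'⟩ := hσ w
    exact ⟨A ⊓ B, hA.inter hB, fun g hg => by
      rw [Representation.tprod_apply, TensorProduct.map_tmul, hA' g hg.1, hB' g hg.2]⟩
  | add x y hx hy => exact hx.add hy

lemma IsSmoothVector.apply [IsTopologicalGroup G] {ρ : Representation ℂ G V} {v : V} (g : G)
    (hv : IsSmoothVector ρ v) : IsSmoothVector ρ (ρ g v) := by
  obtain ⟨A, hA, hA'⟩ := hv
  refine ⟨A.comap (MulAut.conj g⁻¹).toMonoidHom, ?_, fun h hh => ?_⟩
  · have hc : Continuous fun x : G => g⁻¹ * x * g := by fun_prop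
    have : ((A.comap (MulAut.conj g⁻¹).toMonoidHom : Subgroup G) : Set G)
        = (fun x : G => g⁻¹ * x * g) ⁻¹' (A : Set G) := by
      ext x; simp
    rw [this]
    exact hA.preimage hc
  · have h1 : g⁻¹ * h * g ∈ A := by simpa using hh
    have h2 := hA' _ h1
    calc ρ h (ρ g v) = ρ (g * (g⁻¹ * h * g)) v := by
          rw [← Module.End.mul_apply, ← map_mul]; congr 2; group
      _ = ρ g v := by rw [map_mul, Module.End.mul_apply, h2]

/-- The subrepresentation of smooth vectors. -/
def smoothVectors [IsTopologicalGroup G] (ρ : Representation ℂ G V) : Subrepresentation ρ where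
  toSubmodule :=
    { carrier := {v | IsSmoothVector ρ v}
      add_mem' := IsSmoothVector.add
      zero_mem' := isSmoothVector_zero ρ
      smul_mem' := fun c _ hv => hv.smul c }
  apply_mem_toSubmodule g _ hv := IsSmoothVector.apply g hv

lemma isSmooth_smoothVectors [IsTopologicalGroup G] (ρ : Representation ℂ G V) :
    IsSmooth (smoothVectors ρ).toRepresentation := by
  rintro ⟨v, A, hA, hA'⟩
  exact ⟨A, hA, fun g hg => Subtype.ext (hA' g hg)⟩

end Smooth

section Category

variable (G : Type u) [Group G] [TopologicalSpace G]

/-- The property of being smooth, on the category of complex representations of `G`. -/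
def smoothProp : ObjectProperty (Rep.{u} ℂ G) := fun V => IsSmooth V.ρ

instance : (smoothProp G).IsClosedUnderSubobjects where
  prop_of_mono {V W} f _ hW := by
    intro v
    obtain ⟨A, hA, hA'⟩ := hW (f.hom v)
    refine ⟨A, hA, fun g hg => ?_⟩
    have hinj : Function.Injective f.hom := (Rep.mono_iff_injective f).1 inferInstance
    apply hinj
    rw [Rep.hom_comm_apply, hA' g hg]

instance : (smoothProp G).IsClosedUnderQuotients where
  prop_of_epi {V W} f _ hV := by
    intro w
    obtain ⟨v, rfl⟩ := (Rep.epi_iff_surjective f).1 inferInstance w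
    exact (hV v).map f.hom

instance : (smoothProp G).ContainsZero where
  exists_zero := by
    refine ⟨Rep.of (Representation.trivial ℂ G PUnit.{u+1}), ?_, fun v => ?_⟩
    · rw [Limits.IsZero.iff_id_eq_zero]
      ext v
    · exact ⟨⊤, isOpen_univ, fun g _ => rfl⟩

instance : (smoothProp G).IsClosedUnderFiniteProducts :=
  ObjectProperty.IsClosedUnderFiniteProducts.of_isClosedUnderLimitsOfShape.{u} fun J _ =>
    { limitsOfShape_le := by
        rintro V ⟨p⟩ v
        choose A hA hA' using fun j : J => p.prop_diag_obj ⟨j⟩ ((p.π.app ⟨j⟩).hom v)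
        refine ⟨⨅ j, A j, ?_, fun g hg => ?_⟩
        · rw [Subgroup.coe_iInf]
          exact isOpen_iInter_of_finite hA
        · apply Limits.Concrete.isLimit_ext _
            (Limits.isLimitOfPreserves (forget₂ (Rep.{u} ℂ G) (ModuleCat.{u} ℂ)) p.isLimit)
          rintro ⟨j⟩
          have := hA' j g (Subgroup.mem_iInf.1 hg j)
          exact (Rep.hom_comm_apply (p.π.app ⟨j⟩) g v).trans this }

/-- The abelian category `M(G)` of smooth representations of `G`. -/
abbrev SmoothRep := (smoothProp G).FullSubcategory

variable [IsTopologicalGroup G]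

/-- The functor taking a representation to its subrepresentation of smooth vectors. -/
def smoothPart : Rep.{u} ℂ G ⥤ SmoothRep G where
  obj V := ⟨Rep.of (smoothVectors V.ρ).toRepresentation, isSmooth_smoothVectors V.ρ⟩
  map {V W} f := (smoothProp G).homMk (Rep.ofHom
    { toLinearMap := f.hom.toLinearMap.restrict fun _ hv => IsSmoothVector.map f.hom hv
      isIntertwining' := fun g => by
        ext v
        exact Rep.hom_comm_apply f g v.1 })

/-- Taking smooth vectors is right adjoint to the inclusion of smooth representations. -/
def smoothPartAdj : (smoothProp G).ι ⊣ smoothPart G :=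
  Adjunction.mkOfHomEquiv
    { homEquiv := fun V W =>
        { toFun := fun f => (smoothProp G).homMk (Rep.ofHom
            { toLinearMap := f.hom.toLinearMap.codRestrict (smoothVectors W.ρ).toSubmodule
                fun v => IsSmoothVector.map f.hom (V.property v)
              isIntertwining' := fun g => by
                ext v
                exact Rep.hom_comm_apply f g v })
          invFun := fun f => Rep.ofHom
            { toLinearMap := (smoothVectors W.ρ).toSubmodule.subtype ∘ₗ f.hom.hom.toLinearMap
              isIntertwining' := fun g => by
                ext v
                exact congrArg Subtype.val (Rep.hom_comm_apply f.hom g v) }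
          left_inv := fun f => rfl
          right_inv := fun f => rfl }
      homEquiv_naturality_left_symm := fun _ _ => rfl
      homEquiv_naturality_right := fun _ _ => rfl }

instance : EnoughInjectives (Rep.{u} ℂ G) :=
  Rep.equivalenceModuleMonoidAlgebra.enoughInjectives_iff.2
    (ModuleCat.enoughInjectives.{u, u} (MonoidAlgebra ℂ G))

instance : EnoughInjectives (SmoothRep G) :=
  have := (smoothProp G).preservesMonomorphisms_ι_of_isNormalEpiCategory
  EnoughInjectives.of_adjunction (smoothPartAdj G)

instance : HasExt.{u} (SmoothRep G) := hasExt_of_enoughInjectives _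

end Category
section Operations

variable {G : Type u} [Group G] [TopologicalSpace G]

/-- The tensor product of two smooth representations, with the diagonal action. -/
noncomputable def SmoothRep.tensor (V W : SmoothRep G) : SmoothRep G :=
  ⟨Rep.of (V.obj.ρ.tprod W.obj.ρ), V.property.tprod W.property⟩

/-- The smooth contragredient: the smooth vectors of the full linear dual. -/
def SmoothRep.contragredient [IsTopologicalGroup G] (V : SmoothRep G) : SmoothRep G :=
  (smoothPart G).obj (Rep.of V.obj.ρ.dual)

/-- The representation of `G` on the complex line (in the universe `u`) attached to a character. -/
def charRep (χ : G →* ℂˣ) : Representation ℂ G (ULift.{u} ℂ) where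
  toFun g := (χ g : ℂ) • LinearMap.id
  map_one' := by ext; simp
  map_mul' g h := by
    refine LinearMap.ext fun v => ?_
    simp only [map_mul, Units.val_mul, mul_smul]
    rfl

/-- A locally constant character of `G`, as a smooth representation. -/
def SmoothRep.ofChar (χ : G →* ℂˣ) (hχ : IsLocallyConstant χ) :
    SmoothRep G :=
  ⟨Rep.of (charRep χ), fun v => ⟨χ.ker, hχ.isOpen_fiber 1, fun g hg => by
    have h1 : χ g = 1 := hg
    simp [charRep, h1]⟩⟩

variable {V : Type u} [AddCommGroup V] [Module ℂ V]

/-- The space `V^{G,k}` of vectors killed by all `(g₀ - 1)(g₁ - 1)⋯(g_k - 1)`. -/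
def genInvariants (ρ : Representation ℂ G V) (k : ℕ) : Submodule ℂ V where
  carrier := {v | ∀ g : Fin (k + 1) → G, (List.ofFn fun j => ρ (g j) - 1).prod v = 0}
  add_mem' hv hw g := by rw [map_add, hv g, hw g, add_zero]
  zero_mem' g := map_zero _
  smul_mem' c v hv g := by rw [map_smul, hv g, smul_zero]

/-- `Hom_{G,k}(V, W)`: the space `Hom_ℂ(V, W)^{G,k}` for the conjugation action
`(g.φ)(v) = g.(φ(g⁻¹.v))`. -/
abbrev genHom (k : ℕ) (V W : SmoothRep G) : Submodule ℂ (V.obj →ₗ[ℂ] W.obj) :=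
  genInvariants (V.obj.ρ.linHom W.obj.ρ) k

lemma comp_mem_genHom {k : ℕ} {V W W' : SmoothRep G} (f : W ⟶ W') {φ : V.obj →ₗ[ℂ] W.obj}
    (hφ : φ ∈ genHom k V W) : f.hom.hom.toLinearMap ∘ₗ φ ∈ genHom k V W' := by
  intro g
  have key : ∀ (l : List G) (ψ : V.obj →ₗ[ℂ] W.obj),
      (l.map fun a => V.obj.ρ.linHom W'.obj.ρ a - 1).prod (f.hom.hom.toLinearMap ∘ₗ ψ) =
        f.hom.hom.toLinearMap ∘ₗ (l.map fun a => V.obj.ρ.linHom W.obj.ρ a - 1).prod ψ := by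
    intro l
    induction l with
    | nil => intro ψ; rfl
    | cons a l ih =>
      intro ψ
      simp only [List.map_cons, List.prod_cons, Module.End.mul_apply, ih]
      ext v
      simp [Representation.linHom_apply, Rep.hom_comm_apply]
  have h1 := key (List.ofFn g) φ
  rw [List.map_ofFn, List.map_ofFn] at h1
  refine h1.trans ?_
  have h2 := hφ g
  simp only [Function.comp_def]
  rw [h2, LinearMap.comp_zero]

/-- The functor `Hom_{G,k}(V, ·)` from smooth representations to complex vector spaces. -/
def genHomFunctor (k : ℕ) (V : SmoothRep G) : SmoothRep G ⥤ ModuleCat.{u} ℂ where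
  obj W := ModuleCat.of ℂ (genHom k V W)
  map {W W'} f := ModuleCat.ofHom
    ((LinearMap.compRight ℂ f.hom.hom.toLinearMap).restrict fun _ hφ => comp_mem_genHom f hφ)

instance (k : ℕ) (V : SmoothRep G) : (genHomFunctor k V).Additive where
  map_add := rfl

variable [IsTopologicalGroup G]

/-- `Ext^i_G(V, W)` in the abelian category of smooth representations, `i ∈ ℤ`
(zero in negative degrees). -/
def extG (V W : SmoothRep G) : ℤ → Type u
  | .ofNat n => Abelian.Ext V W n
  | .negSucc _ => PUnit

/-- `Ext^i_{G,k}(V, W)`: the derived functors of `Hom_{G,k}`, computed from an injective resolution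
of `W` in the category of smooth representations, `i ∈ ℤ` (zero in negative degrees). -/
noncomputable def genExt (k : ℕ) (V W : SmoothRep G) : ℤ → Type u
  | .ofNat n => ((genHomFunctor k V).rightDerived n).obj W
  | .negSucc _ => PUnit

end Operations
section Sheaf

instance : Limits.PreservesFilteredColimits (forget (ModuleCat.{u} ℂ)) :=
  have : Limits.PreservesFilteredColimits (forget₂ (ModuleCat.{u} ℂ) AddCommGrpCat.{u}) :=
    ⟨fun _ _ _ => inferInstance⟩
  Limits.comp_preservesFilteredColimits (forget₂ (ModuleCat.{u} ℂ) AddCommGrpCat.{u})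
    (forget AddCommGrpCat.{u})

variable {X : Type u} [TopologicalSpace X]

/-- An `ℓ`-sheaf on `X`: a sheaf of complex vector spaces. -/
abbrev LSh (X : Type u) [TopologicalSpace X] := TopCat.Sheaf (ModuleCat.{u} ℂ) (TopCat.of X)

/-- The stalk `F_x`. -/
abbrev LSh.Stalk (F : LSh X) (x : X) : Type u :=
  (TopCat.Presheaf.stalk (X := TopCat.of X) F.presheaf x : ModuleCat.{u} ℂ)

/-- The étalé space `⊔_x F_x` of germs, with its usual topology. -/
abbrev LSh.Total (F : LSh X) : Type u := F.presheaf.EtaleSpace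

/-- The base point of a germ. -/
def LSh.base {F : LSh X} (e : F.Total) : X := TopCat.Presheaf.EtaleSpace.base e

/-- The germ `v ∈ F_x` as a point of the étalé space. -/
def LSh.pt (F : LSh X) (x : X) (v : F.Stalk x) : F.Total :=
  TopCat.Presheaf.EtaleSpace.mk (X := TopCat.of X) x v

lemma LSh.continuous_base (F : LSh X) : Continuous (LSh.base (F := F)) :=
  TopCat.Presheaf.EtaleSpace.continuous_base F.presheaf

/-- A continuous map to the étalé space is locally given by the germs of a section. -/
lemma LSh.exists_section {F : LSh X} {T : Type*} [TopologicalSpace T] {b : T → X}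
    {s : ∀ t, F.Stalk (b t)} (hs : Continuous fun t => F.pt (b t) (s t)) (t : T) :
    ∃ (U : Opens (TopCat.of X)) (f : F.presheaf.obj (Opposite.op U)),
      ∀ᶠ t' in nhds t, ∃ h : b t' ∈ U, s t' = F.presheaf.germ U (b t') h f := by
  obtain ⟨U, -, f, hf⟩ := TopCat.Presheaf.EtaleSpace.exists_section_of_tendsto (hs.tendsto t)
  exact ⟨U, f, hf⟩

lemma LSh.continuous_of_section {F : LSh X} {T : Type*} [TopologicalSpace T] {b : T → X}
    (hb : Continuous b) {s : ∀ t, F.Stalk (b t)}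
    (h : ∀ t, ∃ (U : Opens (TopCat.of X)) (f : F.presheaf.obj (Opposite.op U)),
      ∀ᶠ t' in nhds t, ∃ h : b t' ∈ U, s t' = F.presheaf.germ U (b t') h f) :
    Continuous fun t => F.pt (b t) (s t) := by
  refine continuous_generateFrom_iff.2 ?_
  rintro _ ⟨V, f', rfl⟩
  rw [isOpen_iff_mem_nhds]
  rintro t ⟨htV, ht⟩
  obtain ⟨U, f, hf⟩ := h t
  obtain ⟨htU, hsU⟩ := hf.self_of_nhds
  obtain ⟨W, hW, i, j, hij⟩ := F.presheaf.germ_eq (b t) htU htV f f' (hsU.symm.trans ht)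
  have hbW : ∀ᶠ t' in nhds t, b t' ∈ W := hb.continuousAt.eventually (W.isOpen.mem_nhds hW)
  filter_upwards [hf, hbW] with t' ⟨h1, h2⟩ h3
  refine ⟨j.le h3, ?_⟩
  refine h2.trans ?_
  rw [← F.presheaf.germ_res_apply i (b t') h3, hij, F.presheaf.germ_res_apply]
  rfl

/-- Two continuous lifts to the étalé space of the same map to `X` agree on an open set. -/
lemma LSh.isOpen_eq {F : LSh X} {T : Type*} [TopologicalSpace T] {b : T → X}
    (hb : Continuous b) {s s' : ∀ t, F.Stalk (b t)}
    (hs : Continuous fun t => F.pt (b t) (s t)) (hs' : Continuous fun t => F.pt (b t) (s' t)) :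
    IsOpen {t | s t = s' t} := by
  rw [isOpen_iff_mem_nhds]
  intro t ht
  obtain ⟨U, f, hf⟩ := LSh.exists_section hs t
  obtain ⟨V, f', hf'⟩ := LSh.exists_section hs' t
  obtain ⟨htU, h1⟩ := hf.self_of_nhds
  obtain ⟨htV, h2⟩ := hf'.self_of_nhds
  obtain ⟨W, hW, i, j, hij⟩ := F.presheaf.germ_eq (b t) htU htV f f'
    (h1.symm.trans (ht.trans h2))
  have hbW : ∀ᶠ t' in nhds t, b t' ∈ W := hb.continuousAt.eventually (W.isOpen.mem_nhds hW)
  filter_upwards [hf, hf', hbW] with t' ⟨_, h3⟩ ⟨_, h4⟩ h5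
  show s t' = s' t'
  rw [h3, h4, ← F.presheaf.germ_res_apply i (b t') h5, hij, F.presheaf.germ_res_apply]

lemma LSh.continuous_zero (F : LSh X) {T : Type*} [TopologicalSpace T] {b : T → X}
    (hb : Continuous b) : Continuous fun t => F.pt (b t) (0 : F.Stalk (b t)) :=
  LSh.continuous_of_section hb fun _ => ⟨⊤, 0, Filter.Eventually.of_forall fun t' =>
    ⟨trivial, (map_zero (F.presheaf.germ ⊤ (b t') trivial).hom).symm⟩⟩

lemma LSh.continuous_smul {F : LSh X} {T : Type*} [TopologicalSpace T] {b : T → X}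
    (hb : Continuous b) (c : ℂ) {s : ∀ t, F.Stalk (b t)}
    (hs : Continuous fun t => F.pt (b t) (s t)) :
    Continuous fun t => F.pt (b t) (c • s t) :=
  LSh.continuous_of_section hb fun t => by
    obtain ⟨U, f, hf⟩ := LSh.exists_section hs t
    refine ⟨U, c • f, ?_⟩
    filter_upwards [hf] with t' ⟨h, h'⟩
    exact ⟨h, by rw [h']; exact (map_smul (F.presheaf.germ U (b t') h).hom c f).symm⟩

lemma LSh.continuous_add {F : LSh X} {T : Type*} [TopologicalSpace T] {b : T → X}
    (hb : Continuous b) {s s' : ∀ t, F.Stalk (b t)}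
    (hs : Continuous fun t => F.pt (b t) (s t)) (hs' : Continuous fun t => F.pt (b t) (s' t)) :
    Continuous fun t => F.pt (b t) (s t + s' t) :=
  LSh.continuous_of_section hb fun t => by
    obtain ⟨U, f, hf⟩ := LSh.exists_section hs t
    obtain ⟨V, f', hf'⟩ := LSh.exists_section hs' t
    let i : U ⊓ V ⟶ U := homOfLE inf_le_left
    let j : U ⊓ V ⟶ V := homOfLE inf_le_right
    refine ⟨U ⊓ V, F.presheaf.map i.op f + F.presheaf.map j.op f', ?_⟩
    filter_upwards [hf, hf'] with t' ⟨h1, h2⟩ ⟨h3, h4⟩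
    refine ⟨⟨h1, h3⟩, ?_⟩
    rw [h2, h4]
    refine Eq.trans ?_ (map_add (F.presheaf.germ (U ⊓ V) (b t') ⟨h1, h3⟩).hom _ _).symm
    congr 1
    · exact (F.presheaf.germ_res_apply i (b t') ⟨h1, h3⟩ f).symm
    · exact (F.presheaf.germ_res_apply j (b t') ⟨h1, h3⟩ f').symm

/-- `Γ_c(F|_Z)` for a subset `Z` of `X`: the compactly supported continuous sections over `Z` of
the étalé space of `F`. (The étalé space of the restricted sheaf `F|_Z` is the part of the étalé
space of `F` lying over `Z`.) For `Z = Set.univ` this is `Γ_c(F)`. -/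
def compactSections (F : LSh X) (Z : Set X) : Submodule ℂ (∀ z : Z, F.Stalk z.1) where
  carrier := {s | Continuous (fun z : Z => F.pt z.1 (s z)) ∧ IsCompact {z : Z | s z ≠ 0}}
  zero_mem' := ⟨F.continuous_zero continuous_subtype_val, by simp⟩
  add_mem' {s s'} hs hs' := by
    have hc := LSh.continuous_add continuous_subtype_val hs.1 hs'.1
    refine ⟨hc, (hs.2.union hs'.2).of_isClosed_subset ?_ ?_⟩
    · exact (LSh.isOpen_eq continuous_subtype_val hc
        (F.continuous_zero continuous_subtype_val)).isClosed_compl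
    · intro z hz
      by_contra h
      simp only [Set.mem_union, Set.mem_ofPred_eq, not_or, not_not] at h
      exact hz (by simp [h.1, h.2])
  smul_mem' c s hs := by
    have hc := LSh.continuous_smul continuous_subtype_val c hs.1
    refine ⟨hc, hs.2.of_isClosed_subset ?_ ?_⟩
    · exact (LSh.isOpen_eq continuous_subtype_val hc
        (F.continuous_zero continuous_subtype_val)).isClosed_compl
    · intro z hz h
      exact hz (by simp [h])

/-- The elements of `Γ_c(F)` are the families of germs of the global sections of `F` with compact
support. -/
lemma mem_compactSections_univ_iff (F : LSh X) (s : ∀ z : (Set.univ : Set X), F.Stalk z.1) :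
    s ∈ compactSections F Set.univ ↔
      ∃ f : F.presheaf.obj (Opposite.op (⊤ : Opens (TopCat.of X))),
        (∀ z, s z = F.presheaf.germ ⊤ z.1 trivial f) ∧
        IsCompact {x : X | F.presheaf.germ (X := TopCat.of X) ⊤ x trivial f ≠ 0} := by
  have hsupp : ∀ f : F.presheaf.obj (Opposite.op (⊤ : Opens (TopCat.of X))),
      (∀ z, s z = F.presheaf.germ ⊤ z.1 trivial f) →
      (IsCompact {z : (Set.univ : Set X) | s z ≠ 0} ↔
        IsCompact {x : X | F.presheaf.germ (X := TopCat.of X) ⊤ x trivial f ≠ 0}) := by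
    intro f hf
    rw [Subtype.isCompact_iff]
    have : (Subtype.val '' {z : (Set.univ : Set X) | s z ≠ 0}) =
        {x : X | F.presheaf.germ (X := TopCat.of X) ⊤ x trivial f ≠ 0} := by
      ext x
      constructor
      · rintro ⟨z, hz, rfl⟩
        exact fun h => hz ((hf z).trans h)
      · intro hx
        exact ⟨⟨x, trivial⟩, fun h => hx ((hf ⟨x, trivial⟩).symm.trans h), rfl⟩
    rw [this]
  constructor
  · rintro ⟨hs, hK⟩
    have hloc : ∀ x : X, ∃ (V : Opens (TopCat.of X)) (f : F.presheaf.obj (Opposite.op V)),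
        x ∈ V ∧ ∀ y (hy : y ∈ V), s ⟨y, trivial⟩ = F.presheaf.germ V y hy f := by
      intro x
      have hs' : Continuous fun y : X => F.pt y (s ⟨y, trivial⟩) :=
        hs.comp (Continuous.subtype_mk continuous_id _)
      obtain ⟨U, f, hf⟩ := LSh.exists_section (b := fun y : X => y) hs' x
      obtain ⟨W, hW, hWo, hxW⟩ := eventually_nhds_iff.1 hf
      let V : Opens (TopCat.of X) := ⟨W, hWo⟩
      have hVU : V ≤ U := fun y hy => (hW y hy).1
      refine ⟨V, F.presheaf.map (homOfLE hVU).op f, hxW, fun y hy => ?_⟩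
      rw [F.presheaf.germ_res_apply]
      exact (hW y hy).2
    choose V f hxV hf using hloc
    obtain ⟨f₀, hf₀, -⟩ := F.existsUnique_gluing' V ⊤ (fun x => homOfLE le_top)
      (fun x _ => Opens.mem_iSup.2 ⟨x, hxV x⟩) f (fun x y => by
        refine TopCat.Presheaf.section_ext F _ _ _ fun z hz => ?_
        rw [F.presheaf.germ_res_apply, F.presheaf.germ_res_apply, ← hf x z hz.1, ← hf y z hz.2])
    have h0 : ∀ z, s z = F.presheaf.germ ⊤ z.1 trivial f₀ := by
      rintro ⟨z, hz⟩
      rw [hf z z (hxV z), ← hf₀ z, F.presheaf.germ_res_apply]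
    exact ⟨f₀, h0, (hsupp f₀ h0).1 hK⟩
  · rintro ⟨f, hf, hK⟩
    refine ⟨LSh.continuous_of_section continuous_subtype_val fun z => ⟨⊤, f, ?_⟩,
      (hsupp f hf).2 hK⟩
    exact Filter.Eventually.of_forall fun z' => ⟨trivial, hf z'⟩

end Sheaf
section Equivariant

variable {G : Type u} [Group G] [TopologicalSpace G]
variable {X : Type u} [TopologicalSpace X] [MulAction G X]

/-- A subset of `X` is `G`-stable. -/
def IsStable (G : Type u) [Group G] {X : Type u} [MulAction G X]
    (Z : Set X) : Prop := ∀ (g : G), ∀ z ∈ Z, g • z ∈ Z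

/-- A `G`-equivariant structure on an `ℓ`-sheaf `F` on `X`: a continuous action of `G` on the étalé
space of `F` for which every `g : G` maps each stalk `F_x` linearly to `F_{g • x}`. The linear map
`act g h : F_x → F_y` is indexed by a proof `h` that `y = g • x`. -/
structure EquivariantStructure (G : Type u) [Group G] [TopologicalSpace G] {X : Type u}
    [TopologicalSpace X] [MulAction G X] (F : LSh X) where
  /-- The map `F_x → F_y` induced by `g`, where `y = g • x`. -/
  act (g : G) {x y : X} (h : g • x = y) : F.Stalk x →ₗ[ℂ] F.Stalk y
  act_one (x : X) : act 1 (one_smul G x) = LinearMap.id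
  act_mul (g g' : G) {x y z : X} (h : g' • x = y) (h' : g • y = z) :
    act (g * g') (by rw [mul_smul, h, h']) = act g h' ∘ₗ act g' h
  continuous_act : Continuous fun p : G × F.Total =>
    F.pt (p.1 • LSh.base p.2) (act p.1 rfl p.2.germ)

namespace EquivariantStructure

variable {F : LSh X} (α : EquivariantStructure G F)

lemma act_mul_apply (g g' : G) {x y z : X} (h : g' • x = y) (h' : g • y = z)
    (h'' : (g * g') • x = z) (v : F.Stalk x) :
    α.act (g * g') h'' v = α.act g h' (α.act g' h v) :=
  congrArg (fun L : F.Stalk x →ₗ[ℂ] F.Stalk z => L v) (α.act_mul g g' h h')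

lemma act_injective (g : G) {x y : X} (h : g • x = y) : Function.Injective (α.act g h) := by
  have h' : g⁻¹ • y = x := by rw [← h, inv_smul_smul]
  refine Function.LeftInverse.injective (g := α.act g⁻¹ h') fun v => ?_
  have key : ∀ (a : G) (ha : a = 1) (h1 : a • x = x), α.act a h1 v = v := by
    rintro a rfl h1
    exact congrArg (fun L : F.Stalk x →ₗ[ℂ] F.Stalk x => L v) (α.act_one x)
  rw [← α.act_mul_apply g⁻¹ g h h' (by rw [inv_mul_cancel, one_smul])]
  exact key _ (inv_mul_cancel g) _

lemma continuous_act_comp {T : Type*} [TopologicalSpace T] {a : T → G} {b c : T → X}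
    (ha : Continuous a) (hac : ∀ t, a t • b t = c t) {s : ∀ t, F.Stalk (b t)}
    (hs : Continuous fun t => F.pt (b t) (s t)) :
    Continuous fun t => F.pt (c t) (α.act (a t) (hac t) (s t)) := by
  obtain rfl : (fun t => a t • b t) = c := funext hac
  exact α.continuous_act.comp (ha.prodMk hs)

variable {Z : Set X} (hZ : IsStable G Z)

/-- The translate `g.s` of a section `s` over a `G`-stable subset: `(g.s)_z = g.s_{g⁻¹ z}`,
that is, `(g.s)_{g z} = g.s_z`. -/
noncomputable def translate (g : G) : (∀ z : Z, F.Stalk z.1) →ₗ[ℂ] (∀ z : Z, F.Stalk z.1) where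
  toFun s z := α.act g (smul_inv_smul g z.1) (s ⟨g⁻¹ • z.1, hZ g⁻¹ z.1 z.2⟩)
  map_add' s s' := by ext z; simp
  map_smul' c s := by ext z; simp

lemma translate_eq (g : G) (s : ∀ z : Z, F.Stalk z.1) (z w : Z) (h : g • w.1 = z.1) :
    α.translate hZ g s z = α.act g h (s w) := by
  obtain ⟨w, hw⟩ := w
  obtain rfl : g⁻¹ • z.1 = w := by rw [← h, inv_smul_smul]
  rfl

lemma translate_one (s : ∀ z : Z, F.Stalk z.1) : α.translate hZ 1 s = s := by
  ext z
  rw [α.translate_eq hZ 1 s z z (one_smul G z.1), α.act_one]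
  rfl

lemma translate_mul (g g' : G) (s : ∀ z : Z, F.Stalk z.1) :
    α.translate hZ (g * g') s = α.translate hZ g (α.translate hZ g' s) := by
  ext z
  let y : Z := ⟨g⁻¹ • z.1, hZ _ _ z.2⟩
  let w : Z := ⟨g'⁻¹ • y.1, hZ _ _ y.2⟩
  have h1 : g' • w.1 = y.1 := smul_inv_smul _ _
  have h2 : g • y.1 = z.1 := smul_inv_smul _ _
  rw [α.translate_eq hZ g _ z y h2, α.translate_eq hZ g' _ y w h1,
    α.translate_eq hZ (g * g') _ z w (by rw [mul_smul, h1, h2]), α.act_mul_apply g g' h1 h2]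

variable [ContinuousSMul G X] [IsTopologicalGroup G]

lemma continuous_translate {s : ∀ z : Z, F.Stalk z.1}
    (hs : Continuous fun z : Z => F.pt z.1 (s z)) :
    Continuous fun p : G × Z => F.pt p.2.1 (α.translate hZ p.1 s p.2) := by
  have hm : Continuous fun p : G × Z => (⟨p.1⁻¹ • p.2.1, hZ _ _ p.2.2⟩ : Z) := by
    refine Continuous.subtype_mk ?_ _
    fun_prop
  exact α.continuous_act_comp (a := fun p : G × Z => p.1) continuous_fst
    (fun p => smul_inv_smul p.1 p.2.1) (hs.comp hm)

lemma translate_mem (g : G) {s : ∀ z : Z, F.Stalk z.1} (hs : s ∈ compactSections F Z) :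
    α.translate hZ g s ∈ compactSections F Z := by
  refine ⟨(α.continuous_translate hZ hs.1).comp (Continuous.prodMk_right g), ?_⟩
  have hm : Continuous fun z : Z => (⟨g • z.1, hZ _ _ z.2⟩ : Z) := by
    refine Continuous.subtype_mk ?_ _
    fun_prop
  convert hs.2.image hm using 1
  ext z
  constructor
  · intro h
    refine ⟨⟨g⁻¹ • z.1, hZ _ _ z.2⟩, fun h0 => h ?_, Subtype.ext (smul_inv_smul _ _)⟩
    rw [α.translate_eq hZ g s z ⟨g⁻¹ • z.1, hZ _ _ z.2⟩ (smul_inv_smul _ _), h0, map_zero]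
  · rintro ⟨w, hw, rfl⟩ h
    rw [α.translate_eq hZ g s _ w rfl] at h
    exact hw (α.act_injective g rfl (h.trans (map_zero _).symm))

/-- The representation of `G` on `Γ_c(F|_Z)`, for a `G`-stable subset `Z`. -/
noncomputable def sectionsRep : Representation ℂ G (compactSections F Z) where
  toFun g := (α.translate hZ g).restrict fun _ hs => α.translate_mem hZ g hs
  map_one' := LinearMap.ext fun s => Subtype.ext (α.translate_one hZ s.1)
  map_mul' g g' := LinearMap.ext fun s => Subtype.ext (α.translate_mul hZ g g' s.1)

lemma isSmooth_sectionsRep : IsSmooth (α.sectionsRep hZ) := by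
  rintro ⟨s, hs, hK⟩
  have hopen : IsOpen {p : G × Z | α.translate hZ p.1 s p.2 = s p.2} :=
    LSh.isOpen_eq (b := fun p : G × Z => p.2.1) (by fun_prop)
      (α.continuous_translate hZ hs) (hs.comp continuous_snd)
  have hN : ∀ᶠ g : G in nhds 1, ∀ z ∈ {z : Z | s z ≠ 0}, α.translate hZ g s z = s z := by
    refine hK.eventually_forall_of_forall_eventually fun z _ => ?_
    refine hopen.mem_nhds ?_
    exact congrFun (α.translate_one hZ s) z
  let S : Subgroup G :=
    { carrier := {g | α.translate hZ g s = s}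
      one_mem' := α.translate_one hZ s
      mul_mem' := fun {g g'} hg hg' => by
        have h1 : α.translate hZ g s = s := hg
        have h2 : α.translate hZ g' s = s := hg'
        show α.translate hZ (g * g') s = s
        rw [α.translate_mul hZ, h2, h1]
      inv_mem' := fun {g} hg => by
        have h1 : α.translate hZ g s = s := hg
        show α.translate hZ g⁻¹ s = s
        conv_lhs => rw [← h1]
        rw [← α.translate_mul hZ, inv_mul_cancel, α.translate_one hZ] }
  refine ⟨S, S.isOpen_of_mem_nhds (g := 1) ?_, fun g hg => Subtype.ext hg⟩
  have hinv : Filter.Tendsto (fun g : G => g⁻¹) (nhds 1) (nhds 1) := by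
    simpa using (continuous_inv (G := G)).tendsto 1
  filter_upwards [hN, hinv.eventually hN] with g h1 h2
  show α.translate hZ g s = s
  ext z
  by_cases hz : s z = 0
  · have hw : s ⟨g⁻¹ • z.1, hZ _ _ z.2⟩ = 0 := by
      by_contra hne
      have h3 := h2 _ hne
      rw [α.translate_eq hZ g⁻¹ s _ z rfl, hz, map_zero] at h3
      exact hne h3.symm
    rw [α.translate_eq hZ g s z ⟨g⁻¹ • z.1, hZ _ _ z.2⟩ (smul_inv_smul _ _), hw, map_zero, hz]
  · exact h1 z hz

/-- `Γ_c(F|_Z)` as a smooth representation of `G`, for a `G`-stable subset `Z` of `X`. -/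
noncomputable def sectionsOn : SmoothRep G :=
  ⟨Rep.of (α.sectionsRep hZ), α.isSmooth_sectionsRep hZ⟩

/-- `Γ_c(F)` as a smooth representation of `G`. -/
noncomputable def sections : SmoothRep G :=
  α.sectionsOn (Z := Set.univ) fun _ _ _ => trivial

/-- `Γ_c(F|_{X_y})` as a smooth representation of `G`, for the fiber `X_y = π⁻¹(y)` of a
`G`-invariant map `π`. -/
noncomputable def fiberSections {Y : Type*} {π : X → Y} (hπ : ∀ (g : G) (x : X), π (g • x) = π x) (y : Y) :
    SmoothRep G :=
  α.sectionsOn (Z := π ⁻¹' {y}) fun g x (hx : π x = y) => (hπ g x).trans hx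

end EquivariantStructure

end Equivariant
end LSheaf

/-! A map from `M ⊗ A` to a contragredient `W^∨` is the same as a linear functional on the
coinvariants of `M ⊗ (A ⊗ W)`. Hence every map `M ⊗ A → W^∨` extends along an equivariant `j : A →
B` exactly when `(M ⊗ A ⊗ W)_G → (M ⊗ B ⊗ W)_G` is injective (`forall_exists_extension_iff`). The
dual has disappeared from this condition, and what remains is local over `Y`: multiplication by
indicators of clopen subsets of `Y` commutes with `G` because `π` is invariant, and the stalk of
`Γ_c(F)` at `y` is `Γ_c(F|_{X_y})`. A class vanishing at each stalk vanishes near each point, and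
finitely many clopen pieces cover its support (`coinvariantsInjective_of_stalks`,
`coinvariantsInjective_sections`).

Vanishing of Ext has to be put in this form. For a compact open subgroup `K`, averaging over `K`
shows that `V ⊗ ℂ[G/K]` is projective. If `A` is the kernel of `V ⊗ ℂ[G/K] → V`, tensoring with `M`
gives `0 → M ⊗ A → M ⊗ (V ⊗ ℂ[G/K]) → M ⊗ V → 0` with projective middle term. So vanishing of
`Ext¹(M ⊗ V, W^∨)` is an extension problem of the above kind, vanishing of Hom is another, and
higher degrees reduce to degree one by replacing `V` with `A`. Only the factor `V` changes, so one
reduction serves `Γ_c(F)` and all its fibers (`subsingleton_ext_sections`).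

For `Ext_{G,k}`, a generalized homomorphism is unipotent, hence fixed, under conjugation by elements
of the compact group `K`. It follows that `Hom_{G,k}(V, ·)` is `Hom_G(V ⊗ T, ·)`, where `T` is the
quotient of `ℂ[G/K]` by all `(g₀ - 1)⋯(g_k - 1)x`. Thus the vanishing of `Ext_{G,k}(V, χ)` is that
of `Ext_G(V ⊗ T, χ)` (`subsingleton_genExt_iff`), and `χ` is the contragredient of `χ⁻¹`, which
brings back the first case. -/

namespace LSheaf

/-! ### Compact open subgroups -/

section CompactOpen

variable {G : Type*} [Group G] [TopologicalSpace G] [IsTopologicalGroup G]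

open scoped Pointwise in
/-- A totally disconnected locally compact group has a compact open subgroup. -/
lemma exists_isCompact_isOpen_subgroup [T2Space G] [LocallyCompactSpace G]
    [TotallyDisconnectedSpace G] :
    ∃ K : Subgroup G, IsOpen (K : Set G) ∧ IsCompact (K : Set G) := by
  obtain ⟨C, hC, h1C⟩ := exists_compact_mem_nhds (1 : G)
  obtain ⟨W, hW, h1W, hWC⟩ :=
    (loc_compact_Haus_tot_disc_of_zero_dim (H := G)).mem_nhds_iff.1 h1C
  have hWc : IsCompact W := hC.of_isClosed_subset hW.isClosed hWC
  -- The stabilizer of a compact open `W ∋ 1` under left translation lies in `W` because it moves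
  -- `1` inside `W`; it is open because compactness of `W` makes `g * w ∈ W` hold uniformly for `g`
  -- near `1`.
  let K : Subgroup G := MulAction.stabilizer G W
  have hKW : (K : Set G) ⊆ W := fun g hg => by
    have h : g • W = W := hg
    rw [← h]
    simpa using Set.smul_mem_smul_set (a := g) h1W
  have hN : ∀ᶠ g : G in nhds 1, ∀ w ∈ W, g * w ∈ W := by
    refine hWc.eventually_forall_of_forall_eventually fun w hw => ?_
    have hc : Continuous fun p : G × G => p.1 * p.2 := continuous_mul
    exact hc.continuousAt.eventually (hW.isOpen.mem_nhds (by simpa using hw))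
  have hinv : Filter.Tendsto (fun g : G => g⁻¹) (nhds 1) (nhds 1) := by
    simpa using (continuous_inv (G := G)).tendsto 1
  have hKo : IsOpen (K : Set G) := by
    refine K.isOpen_of_mem_nhds (g := 1) ?_
    filter_upwards [hN, hinv.eventually hN] with g h1 h2
    show g • W = W
    ext w
    rw [Set.mem_smul_set_iff_inv_smul_mem]
    refine ⟨fun h => ?_, fun h => h2 w h⟩
    simpa using h1 _ h
  exact ⟨K, hKo, hWc.of_isClosed_subset (K.isClosed_of_isOpen hKo) hKW⟩

/-- Some positive power of an element of a compact subgroup lies in a given open subgroup. -/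
lemma exists_pow_mem {K U : Subgroup G} (hK : IsCompact (K : Set G)) (hU : IsOpen (U : Set G))
    {g : G} (hg : g ∈ K) : ∃ m : ℕ, 0 < m ∧ g ^ m ∈ U := by
  have : CompactSpace K := isCompact_iff_compactSpace.1 hK
  let U' : Subgroup K := U.subgroupOf K
  have hU' : IsOpen (U' : Set K) := hU.preimage continuous_subtype_val
  have hfin : Finite (K ⧸ U') := Subgroup.quotient_finite_of_isOpen U' hU'
  have : U'.FiniteIndex := Subgroup.finiteIndex_of_finite_quotient
  obtain ⟨m, hm, -, h⟩ := U'.exists_pow_mem_of_index_ne_zero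
    Subgroup.FiniteIndex.index_ne_zero (⟨g, hg⟩ : K)
  exact ⟨m, hm, h⟩

end CompactOpen

/-! ### Averages of locally constant functions -/

section Average

open MeasureTheory

/-- A vector valued locally constant function on a compact group has an average. -/
lemma exists_average {K : Type*} [TopologicalSpace K] [CompactSpace K] [MeasurableSpace K]
    [BorelSpace K] (μ : Measure K) [IsFiniteMeasure μ] {E : Type*} [AddCommGroup E] [Module ℂ E]
    {f : K → E} (hf : IsLocallyConstant f) :
    ∃ e : E, ∀ l : E →ₗ[ℂ] ℂ, l e = ∫ k, l (f k) ∂μ := by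
  classical
  have hfin : (Set.range f).Finite := hf.range_finite
  have hmeas : ∀ w, MeasurableSet (f ⁻¹' {w}) := fun w => (hf.isOpen_fiber w).measurableSet
  -- `E` carries no topology, so the integral is the finite sum of values weighted by the measures
  -- of their fibers, and it is tested against linear functionals.
  refine ⟨∑ w ∈ hfin.toFinset, (μ.real (f ⁻¹' {w}) : ℂ) • w, fun l => ?_⟩
  have h1 : ∀ k, l (f k) = ∑ w ∈ hfin.toFinset, (f ⁻¹' {w}).indicator (fun _ => l w) k := by
    intro k
    rw [Finset.sum_eq_single (f k)]
    · simp
    · intro w _ hw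
      exact Set.indicator_of_notMem (fun h => hw (Eq.symm h)) _
    · intro h
      simp at h
  simp_rw [h1]
  rw [integral_finsetSum _ fun w _ => (integrable_const (l w)).indicator (hmeas w), map_sum]
  refine Finset.sum_congr rfl fun w _ => ?_
  rw [integral_indicator_const _ (hmeas w), map_smul]
  rfl

end Average

/-! ### Averaging linear lifts over a compact subgroup -/

section Lift

open MeasureTheory

variable {G : Type u} [Group G] [TopologicalSpace G] [IsTopologicalGroup G]
variable {V E E' : Type u} [AddCommGroup V] [Module ℂ V] [AddCommGroup E] [Module ℂ E]
  [AddCommGroup E'] [Module ℂ E']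

/-- For smooth representations, maps equivariant under a compact open subgroup lift along
surjections. -/
lemma exists_equivariant_lift {K : Subgroup G} (hK : IsCompact (K : Set G))
    {ρ : Representation ℂ G V} {σ : Representation ℂ G E} {σ' : Representation ℂ G E'}
    (hρ : IsSmooth ρ) (hσ : IsSmooth σ) (p : σ.IntertwiningMap σ') (hp : Function.Surjective p)
    (φ : V →ₗ[ℂ] E') (hφ : ∀ k ∈ K, ρ.linHom σ' k φ = φ) :
    ∃ ψ : V →ₗ[ℂ] E, (∀ k ∈ K, ρ.linHom σ k ψ = ψ) ∧ p.toLinearMap ∘ₗ ψ = φ := by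
  have : CompactSpace K := isCompact_iff_compactSpace.1 hK
  let _ : MeasurableSpace K := borel K
  have : BorelSpace K := ⟨rfl⟩
  let μ : Measure K := Measure.haarMeasure ⊤
  have hμ : IsProbabilityMeasure μ := ⟨Measure.haarMeasure_self⟩
  -- The section `s` is only linear; the lift `s ∘ φ` becomes `K`-equivariant after averaging its
  -- conjugates `k s φ k⁻¹`.
  obtain ⟨s, hs⟩ := p.toLinearMap.exists_rightInverse_of_surjective (LinearMap.range_eq_top.2 hp)
  have hs' : ∀ x, p (s x) = x := fun x => LinearMap.congr_fun hs x
  have hloc : ∀ v, IsLocallyConstant fun k : K => σ k (s (φ (ρ (k : G)⁻¹ v))) := by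
    intro v
    rw [IsLocallyConstant.iff_eventually_eq]
    intro x
    obtain ⟨A, hA, hA'⟩ := hρ (ρ (x : G)⁻¹ v)
    obtain ⟨B, hB, hB'⟩ := hσ (s (φ (ρ (x : G)⁻¹ v)))
    have hc : Continuous fun k : K => (x : G)⁻¹ * k := by fun_prop
    have h1 : ∀ᶠ k : K in nhds x, (x : G)⁻¹ * k ∈ ((A ⊓ B : Subgroup G) : Set G) :=
      hc.continuousAt.eventually ((hA.inter hB).mem_nhds (by simp))
    filter_upwards [h1] with k hk
    have e1 : ρ (k : G)⁻¹ v = ρ (x : G)⁻¹ v := by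
      rw [← hA' _ (A.inv_mem hk.1), ← Module.End.mul_apply, ← map_mul]
      congr 2
      group
    have e2 : (k : G) = x * ((x : G)⁻¹ * k) := by group
    rw [e1]
    nth_rewrite 1 [e2]
    rw [map_mul, Module.End.mul_apply, hB' _ hk.2]
  choose a ha using fun v => exists_average μ (hloc v)
  have ext : ∀ e e' : E, (∀ l : E →ₗ[ℂ] ℂ, l e = l e') → e = e' := fun e e' h => by
    rw [← sub_eq_zero, ← Module.forall_dual_apply_eq_zero_iff ℂ]
    intro l
    rw [map_sub, h, sub_self]
  have hint : ∀ v (l : E →ₗ[ℂ] ℂ), Integrable (fun k : K => l (σ k (s (φ (ρ (k : G)⁻¹ v))))) μ :=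
    fun v l => ((hloc v).comp l).continuous.integrable_of_hasCompactSupport
      (HasCompactSupport.of_compactSpace _)
  let ψ : V →ₗ[ℂ] E :=
    { toFun := a
      map_add' := fun v w => ext _ _ fun l => by
        rw [map_add, ha, ha, ha, ← integral_add (hint v l) (hint w l)]
        simp
      map_smul' := fun c v => ext _ _ fun l => by
        rw [RingHom.id_apply, map_smul, ha, ha, ← integral_smul]
        simp }
  refine ⟨ψ, fun k hk => ?_, ?_⟩
  · refine LinearMap.ext fun v => ext _ _ fun l => ?_
    have h1 : l (σ k (a (ρ k⁻¹ v))) = _ := ha (ρ k⁻¹ v) (l ∘ₗ σ k)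
    have h2 : l (a v) = _ := ha v l
    rw [← integral_mul_left_eq_self _ (⟨k, hk⟩ : K)] at h2
    rw [Representation.linHom_apply]
    refine h1.trans (Eq.trans ?_ h2.symm)
    simp
  · refine LinearMap.ext fun v => ?_
    show p (a v) = φ v
    rw [← sub_eq_zero, ← Module.forall_dual_apply_eq_zero_iff ℂ]
    intro l
    have h1 : l (p (a v)) = _ := ha v (l ∘ₗ p.toLinearMap)
    rw [map_sub, h1, sub_eq_zero]
    -- After applying `p` the integrand is constant, as `p s = 1` and `φ` is `K`-equivariant; the
    -- total mass is `1`.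
    have h2 : ∀ k : K, (l ∘ₗ p.toLinearMap) (σ k (s (φ (ρ (k : G)⁻¹ v)))) = l (φ v) := by
      intro k
      have h3 := LinearMap.congr_fun (hφ k k.2) v
      rw [Representation.linHom_apply] at h3
      conv_rhs => rw [← h3]
      show l (p (σ k _)) = _
      rw [p.isIntertwining, hs']
      rfl
    simp_rw [h2]
    simp

end Lift

/-! ### The permutation representation on cosets -/

section Perm

variable {G : Type u} [Group G]

/-- The permutation representation on the finitely supported functions on `G ⧸ K`. -/
noncomputable def cosetRep (K : Subgroup G) : Representation ℂ G (G ⧸ K →₀ ℂ) where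
  toFun g := Finsupp.lmapDomain ℂ ℂ (g • ·)
  map_one' := by ext; simp
  map_mul' g h := by ext; simp [mul_smul]

@[simp]
lemma cosetRep_single (K : Subgroup G) (g : G) (x : G ⧸ K) (c : ℂ) :
    cosetRep K g (Finsupp.single x c) = Finsupp.single (g • x) c := by
  simp [cosetRep]

lemma cosetRep_single_one (K : Subgroup G) (g : G) (c : ℂ) :
    cosetRep K g (Finsupp.single ((1 : G) : G ⧸ K) c) = Finsupp.single (g : G ⧸ K) c := by
  rw [cosetRep_single]
  congr 1
  show ((g * 1 : G) : G ⧸ K) = _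
  rw [mul_one]

lemma isSmooth_cosetRep [TopologicalSpace G] [IsTopologicalGroup G] {K : Subgroup G}
    (hK : IsOpen (K : Set G)) : IsSmooth (cosetRep K) := by
  intro f
  induction f using Finsupp.induction_linear with
  | zero => exact isSmoothVector_zero _
  | add f f' hf hf' => exact hf.add hf'
  | single x c =>
    obtain ⟨g, rfl⟩ := QuotientGroup.mk_surjective x
    have h : IsSmoothVector (cosetRep K) (Finsupp.single ((1 : G) : G ⧸ K) c) := by
      refine ⟨K, hK, fun k hk => ?_⟩
      rw [cosetRep_single_one]
      congr 1
      rw [QuotientGroup.eq, mul_one]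
      exact K.inv_mem hk
    have h' := h.apply g
    rwa [cosetRep_single_one] at h'

variable {M : Type u} [AddCommGroup M] [Module ℂ M]

/-- A `K`-fixed vector of a representation of `G` gives an equivariant map from the permutation
representation on `G ⧸ K`. -/
noncomputable def orbitMap {K : Subgroup G} (ρ : Representation ℂ G M) (m : M)
    (hm : ∀ k ∈ K, ρ k m = m) : (cosetRep K).IntertwiningMap ρ where
  toLinearMap := Finsupp.linearCombination ℂ (Quotient.lift (fun g => ρ g m) fun g g' h => by
    have h1 : g⁻¹ * g' ∈ K := QuotientGroup.leftRel_apply.1 h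
    have h2 : g' = g * (g⁻¹ * g') := by group
    show ρ g m = ρ g' m
    rw [h2, map_mul, Module.End.mul_apply, hm _ h1])
  isIntertwining' g := by
    ext x
    obtain ⟨h, rfl⟩ := QuotientGroup.mk_surjective x
    simp only [LinearMap.comp_apply, Finsupp.lsingle_apply, cosetRep_single,
      Finsupp.linearCombination_single, one_smul]
    show ρ (g * h) m = ρ g (ρ h m)
    rw [map_mul, Module.End.mul_apply]

lemma orbitMap_single {K : Subgroup G} (ρ : Representation ℂ G M) (m : M)
    (hm : ∀ k ∈ K, ρ k m = m) (g : G) :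
    orbitMap ρ m hm (Finsupp.single (g : G ⧸ K) 1) = ρ g m := by
  show Finsupp.linearCombination ℂ _ (Finsupp.single _ _) = _
  rw [Finsupp.linearCombination_single, one_smul]
  rfl

variable {V W A : Type u} [AddCommGroup V] [Module ℂ V] [AddCommGroup W] [Module ℂ W]
  [AddCommGroup A] [Module ℂ A]
  {ρ : Representation ℂ G V} {σ : Representation ℂ G A} {τ : Representation ℂ G W}

/-- Equivariant maps `A → Hom(V, W)` give equivariant maps `V ⊗ A → W`. -/
noncomputable def uncurryHom (f : σ.IntertwiningMap (ρ.linHom τ)) :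
    (ρ.tprod σ).IntertwiningMap τ where
  toLinearMap := TensorProduct.lift f.toLinearMap.flip
  isIntertwining' g := by
    ext v a
    have h := LinearMap.congr_fun (f.isIntertwining _ _ g a) (ρ g v)
    rw [Representation.linHom_apply] at h
    simpa using h

end Perm

/-! ### Coinvariants and localization over the base -/

section Coinvariants

open Representation
open scoped TensorProduct

variable {G : Type u} [Group G]
variable {M N A B : Type u} [AddCommGroup M] [Module ℂ M] [AddCommGroup N] [Module ℂ N]
  [AddCommGroup A] [Module ℂ A] [AddCommGroup B] [Module ℂ B]

lemma coinvariantsKer_map {ρ : Representation ℂ G M} {ν : Representation ℂ G N}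
    (f : ρ.IntertwiningMap ν) {m : M} (hm : m ∈ Coinvariants.ker ρ) :
    f m ∈ Coinvariants.ker ν := by
  have h : Coinvariants.ker ρ ≤ (Coinvariants.ker ν).comap f.toLinearMap := by
    refine Submodule.span_le.2 ?_
    rintro _ ⟨⟨g, x⟩, rfl⟩
    show f (ρ g x - x) ∈ Coinvariants.ker ν
    rw [map_sub, f.isIntertwining]
    exact Coinvariants.sub_mem_ker g (f x)
  exact h hm

/-- Each generator `ν g x - x` lifts to `ρ g m - m` for any lift `m` of `x`. This allows a relation
found on a stalk to be lifted to a relation on the whole space. -/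
lemma exists_mem_coinvariantsKer {ρ : Representation ℂ G M} {ν : Representation ℂ G N}
    (f : ρ.IntertwiningMap ν) (hf : Function.Surjective f) {n : N}
    (hn : n ∈ Coinvariants.ker ν) : ∃ m ∈ Coinvariants.ker ρ, f m = n := by
  have h : Coinvariants.ker ν ≤ (Coinvariants.ker ρ).map f.toLinearMap := by
    refine Submodule.span_le.2 ?_
    rintro _ ⟨⟨g, x⟩, rfl⟩
    obtain ⟨m, rfl⟩ := hf x
    refine ⟨ρ g m - m, Coinvariants.sub_mem_ker g m, ?_⟩
    show f (ρ g m - m) = _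
    rw [map_sub, f.isIntertwining]
  exact h hn

/-- The map `(M ⊗ A)_G → (M ⊗ B)_G` on coinvariants induced by `j : A → B` is injective. -/
def CoinvariantsInjective (ρ : Representation ℂ G M) {σ : Representation ℂ G A}
    {τ : Representation ℂ G B} (j : σ.IntertwiningMap τ) : Prop :=
  ∀ c : M ⊗[ℂ] A, j.lTensor ρ c ∈ Coinvariants.ker (ρ.tprod τ) →
    c ∈ Coinvariants.ker (ρ.tprod σ)

/-- Localization over `Y`: suppose that the clopen subsets of `Y` act on `M` like multiplication by
indicator functions, and `N y` is the stalk of `M` at `y`. Then injectivity on coinvariants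
can be checked on the stalks. -/
theorem coinvariantsInjective_of_stalks {Y : Type*} [TopologicalSpace Y]
    {ρ : Representation ℂ G M} {σ : Representation ℂ G A} {τ : Representation ℂ G B}
    (j : σ.IntertwiningMap τ)
    {N : Y → Type u} [∀ y, AddCommGroup (N y)] [∀ y, Module ℂ (N y)]
    {ν : ∀ y, Representation ℂ G (N y)} (r : ∀ y, ρ.IntertwiningMap (ν y))
    (hr : ∀ y, Function.Surjective (r y)) (e : Clopens Y → ρ.IntertwiningMap ρ)
    (hsup : ∀ U V m, e (U ⊔ V) m = e U m + e Uᶜ (e V m))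
    (hle : ∀ U V m, U ≤ V → e U (e V m) = e U m)
    (hge : ∀ U V m, U ≤ V → e V (e U m) = e U m)
    (hker : ∀ y m, r y m = 0 → ∃ U : Clopens Y, y ∈ U ∧ e U m = 0)
    (hsupp : ∀ m, ∃ W : Clopens Y, IsCompact (W : Set Y) ∧ e W m = m)
    (h : ∀ y, CoinvariantsInjective (ν y) j) : CoinvariantsInjective ρ j := by
  -- The properties of the operators `e U` on `M` are carried over to `M ⊗ A`.
  have hsup' : ∀ U V (c : M ⊗[ℂ] A), (e (U ⊔ V)).rTensor σ c =
      (e U).rTensor σ c + (e Uᶜ).rTensor σ ((e V).rTensor σ c) := by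
    intro U V c
    induction c using TensorProduct.induction_on with
    | zero => simp
    | tmul m a => simp [hsup, TensorProduct.add_tmul]
    | add x y hx hy => rw [map_add, hx, hy]; simp only [map_add]; abel
  have hle' : ∀ U V (c : M ⊗[ℂ] A), U ≤ V →
      (e U).rTensor σ ((e V).rTensor σ c) = (e U).rTensor σ c := by
    intro U V c hUV
    induction c using TensorProduct.induction_on with
    | zero => simp
    | tmul m a => simp [hle U V m hUV]
    | add x y hx hy => simp only [map_add, hx, hy]
  have hge' : ∀ U V (c : M ⊗[ℂ] A), U ≤ V → (e U).rTensor σ c = c → (e V).rTensor σ c = c := by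
    intro U V c hUV hc
    rw [← hc]
    clear hc
    induction c using TensorProduct.induction_on with
    | zero => simp
    | tmul m a => simp [hge U V m hUV]
    | add x y hx hy => simp only [map_add, hx, hy]
  have hsupp' : ∀ c : M ⊗[ℂ] A, ∃ W : Clopens Y, IsCompact (W : Set Y) ∧
      (e W).rTensor σ c = c := by
    intro c
    induction c using TensorProduct.induction_on with
    | zero => exact ⟨⊥, by simp, map_zero _⟩
    | tmul m a =>
      obtain ⟨W, hW, hm⟩ := hsupp m
      exact ⟨W, hW, by rw [IntertwiningMap.rTensor_apply, hm]⟩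
    | add x y hx hy =>
      obtain ⟨W, hW, hx⟩ := hx
      obtain ⟨W', hW', hy⟩ := hy
      refine ⟨W ⊔ W', by rw [Clopens.coe_sup]; exact hW.union hW', ?_⟩
      rw [map_add, hge' W _ x le_sup_left hx, hge' W' _ y le_sup_right hy]
  have hker' : ∀ y (c : M ⊗[ℂ] A), (r y).rTensor σ c = 0 →
      ∃ U : Clopens Y, y ∈ U ∧ (e U).rTensor σ c = 0 := by
    intro z c hc
    have hex : Function.Exact (LinearMap.ker (r z).toLinearMap).subtype (r z).toLinearMap :=
      LinearMap.exact_subtype_ker_map _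
    -- By right exactness `c` comes from `ker (r z) ⊗ A`, so it is a finite sum of tensors each
    -- killed near `z`; the finitely many neighborhoods are intersected.
    obtain ⟨t, rfl⟩ := (rTensor_exact A hex (hr z) c).1 hc
    clear hc
    induction t using TensorProduct.induction_on with
    | zero => exact ⟨⊤, trivial, by simp⟩
    | tmul m a =>
      obtain ⟨U, hU, hm⟩ := hker z m.1 m.2
      refine ⟨U, hU, ?_⟩
      rw [LinearMap.rTensor_tmul, IntertwiningMap.rTensor_apply]
      exact (congrArg (· ⊗ₜ[ℂ] a) hm).trans (TensorProduct.zero_tmul _ _)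
    | add x y hx hy =>
      obtain ⟨U, hU, hx⟩ := hx
      obtain ⟨V, hV, hy⟩ := hy
      refine ⟨U ⊓ V, ⟨hU, hV⟩, ?_⟩
      have h1 := hle' (U ⊓ V) U (LinearMap.rTensor A (LinearMap.ker (r z).toLinearMap).subtype x)
        inf_le_left
      have h2 := hle' (U ⊓ V) V (LinearMap.rTensor A (LinearMap.ker (r z).toLinearMap).subtype y)
        inf_le_right
      rw [hx, map_zero] at h1
      rw [hy, map_zero] at h2
      exact (congrArg _ (map_add _ x y)).trans
        ((map_add _ _ _).trans (by rw [← h1, ← h2, add_zero]))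
  -- Not among the hypotheses: `hsup` at `⊥, ⊥` gives `e ⊥ = e ⊥ + e ⊤ (e ⊥)`, and `e ⊤ (e ⊥) = e
  -- ⊥`.
  have hbot' : ∀ c : M ⊗[ℂ] A, (e ⊥).rTensor σ c = 0 := by
    intro c
    have h1 := hsup' ⊥ ⊥ c
    rw [compl_bot, sup_idem] at h1
    have h2 : (e ⊤).rTensor σ ((e ⊥).rTensor σ c) = (e ⊥).rTensor σ c :=
      hge' ⊥ ⊤ _ bot_le (hle' ⊥ ⊥ c le_rfl)
    rw [h2] at h1
    simpa using h1
  have hcomm : ∀ y (c : M ⊗[ℂ] A),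
      j.lTensor (ν y) ((r y).rTensor σ c) = (r y).rTensor τ (j.lTensor ρ c) := by
    intro y c
    induction c using TensorProduct.induction_on with
    | zero => simp
    | tmul m a => simp
    | add x y hx hy => simp only [map_add, hx, hy]
  intro c hc
  -- On the stalk, `c` becomes a relation, which lifts to a relation `d`. Since `c - d` dies at `y`,
  -- it dies on a neighborhood `U`, where `e U c = e U d` is a relation.
  have hloc : ∀ y, ∃ U : Clopens Y, y ∈ U ∧
      (e U).rTensor σ c ∈ Coinvariants.ker (ρ.tprod σ) := by
    intro y
    have h2 := h y ((r y).rTensor σ c) (hcomm y c ▸ coinvariantsKer_map ((r y).rTensor τ) hc)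
    obtain ⟨d, hd, hdc⟩ := exists_mem_coinvariantsKer ((r y).rTensor σ)
      (LinearMap.rTensor_surjective A (hr y)) h2
    obtain ⟨U, hU, hUc⟩ := hker' y (c - d) (by rw [map_sub, hdc, sub_self])
    refine ⟨U, hU, ?_⟩
    rw [map_sub, sub_eq_zero] at hUc
    rw [hUc]
    exact coinvariantsKer_map _ hd
  obtain ⟨W, hW, hWc⟩ := hsupp' c
  -- Compactness induction; two pieces are joined by `e (U ⊔ V) = e U + e Uᶜ (e V)`, and each `e`
  -- preserves relations.
  have key : ∃ U : Clopens Y, (W : Set Y) ⊆ U ∧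
      (e U).rTensor σ c ∈ Coinvariants.ker (ρ.tprod σ) := by
    refine hW.induction_on (p := fun S => ∃ U : Clopens Y, S ⊆ U ∧
      (e U).rTensor σ c ∈ Coinvariants.ker (ρ.tprod σ)) ?_ ?_ ?_ ?_
    · refine ⟨⊥, Set.empty_subset _, ?_⟩
      rw [hbot']
      exact zero_mem _
    · rintro S T hST ⟨U, hU, h'⟩
      exact ⟨U, hST.trans hU, h'⟩
    · rintro S T ⟨U, hU, h1⟩ ⟨V, hV, h2⟩
      refine ⟨U ⊔ V, ?_, ?_⟩
      · rw [Clopens.coe_sup]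
        exact Set.union_subset_union hU hV
      · rw [hsup']
        exact add_mem h1 (coinvariantsKer_map _ h2)
    · intro y _
      obtain ⟨U, hU, h'⟩ := hloc y
      exact ⟨U, mem_nhdsWithin_of_mem_nhds (U.isOpen.mem_nhds hU), U, subset_rfl, h'⟩
  obtain ⟨U, hWU, hU⟩ := key
  rw [← hWc, ← hle' W U c hWU]
  exact coinvariantsKer_map _ hU

end Coinvariants

/-! ### Compactly supported sections: cutoff and restriction -/

section Sections

variable {X : Type u} [TopologicalSpace X] {F : LSh X} {Z : Set X}

/-- Compact subsets of a locally compact totally disconnected Hausdorff space have compact clopen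
neighborhoods. -/
lemma exists_compact_clopen_superset {Y : Type*} [TopologicalSpace Y] [T2Space Y]
    [LocallyCompactSpace Y] [TotallyDisconnectedSpace Y] {S : Set Y} (hS : IsCompact S) :
    ∃ W : Clopens Y, IsCompact (W : Set Y) ∧ S ⊆ W := by
  refine hS.induction_on (p := fun S => ∃ W : Clopens Y, IsCompact (W : Set Y) ∧ S ⊆ W)
    ⟨⊥, by simp, Set.empty_subset _⟩ ?_ ?_ ?_
  · rintro S T hST ⟨W, hW, h⟩
    exact ⟨W, hW, hST.trans h⟩
  · rintro S T ⟨W, hW, h⟩ ⟨W', hW', h'⟩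
    refine ⟨W ⊔ W', ?_, ?_⟩ <;> rw [Clopens.coe_sup]
    exacts [hW.union hW', Set.union_subset_union h h']
  · intro y _
    obtain ⟨C, hC, hyC⟩ := exists_compact_mem_nhds y
    obtain ⟨W, hW, hyW, hWC⟩ :=
      (loc_compact_Haus_tot_disc_of_zero_dim (H := Y)).mem_nhds_iff.1 hyC
    exact ⟨W, mem_nhdsWithin_of_mem_nhds (hW.isOpen.mem_nhds hyW), ⟨W, hW⟩,
      hC.of_isClosed_subset hW.isClosed hWC, subset_rfl⟩

open Classical in
/-- Multiplication of families of germs by the indicator function of a set. -/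
noncomputable def cutoff (F : LSh X) (Z C : Set X) :
    (∀ z : Z, F.Stalk z.1) →ₗ[ℂ] (∀ z : Z, F.Stalk z.1) where
  toFun s z := if z.1 ∈ C then s z else 0
  map_add' s s' := by ext z; by_cases h : z.1 ∈ C <;> simp [h]
  map_smul' c s := by ext z; by_cases h : z.1 ∈ C <;> simp [h]

lemma cutoff_of_mem {C : Set X} (s : ∀ z : Z, F.Stalk z.1) {z : Z} (h : z.1 ∈ C) :
    cutoff F Z C s z = s z := if_pos h

lemma cutoff_of_notMem {C : Set X} (s : ∀ z : Z, F.Stalk z.1) {z : Z} (h : z.1 ∉ C) :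
    cutoff F Z C s z = 0 := if_neg h

/-- Over the clopen complement the family is the zero section. Continuity of `s` is required over
`C` alone, so that germs of a section defined only near `C` may be extended by zero. -/
lemma continuous_cutoff {C : Set X} (hC : IsClopen C) {s : ∀ z : Z, F.Stalk z.1}
    (hs : ContinuousOn (fun z : Z => F.pt z.1 (s z)) {z | z.1 ∈ C}) :
    Continuous fun z : Z => F.pt z.1 (cutoff F Z C s z) := by
  have hC' : IsClopen {z : Z | z.1 ∈ C} := hC.preimage continuous_subtype_val
  rw [continuous_iff_continuousAt]
  intro z
  by_cases hz : z.1 ∈ C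
  · have h := hs.continuousAt (hC'.isOpen.mem_nhds hz)
    refine h.congr ?_
    filter_upwards [hC'.isOpen.mem_nhds hz] with w hw
    rw [cutoff_of_mem _ hw]
  · have h := (F.continuous_zero (T := Z) continuous_subtype_val).continuousAt (x := z)
    refine h.congr ?_
    filter_upwards [hC'.compl.isOpen.mem_nhds hz] with w hw
    have hw' : w.1 ∉ C := hw
    rw [cutoff_of_notMem _ hw']

/-- Sections that agree at a point agree nearby, even though the étalé space need not be Hausdorff;
so the set of nonzero germs needs no closure. -/
lemma isClosed_support {s : ∀ z : Z, F.Stalk z.1} (hs : Continuous fun z : Z => F.pt z.1 (s z)) :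
    IsClosed {z : Z | s z ≠ 0} :=
  (LSh.isOpen_eq continuous_subtype_val hs
    (F.continuous_zero continuous_subtype_val)).isClosed_compl

lemma cutoff_mem {C : Set X} (hC : IsClopen C) {s : ∀ z : Z, F.Stalk z.1}
    (hs : s ∈ compactSections F Z) : cutoff F Z C s ∈ compactSections F Z := by
  have h := continuous_cutoff hC hs.1.continuousOn
  refine ⟨h, hs.2.of_isClosed_subset (isClosed_support h) fun z hz h0 => hz ?_⟩
  by_cases hzC : z.1 ∈ C
  · rw [cutoff_of_mem _ hzC, h0]
  · rw [cutoff_of_notMem _ hzC]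

/-- The restriction of a compactly supported section to a closed subset. -/
noncomputable def restrictSections (F : LSh X) {Z : Set X} (hZ : IsClosed Z) :
    compactSections F Set.univ →ₗ[ℂ] compactSections F Z where
  toFun s := ⟨fun z => s.1 ⟨z.1, trivial⟩,
    s.2.1.comp (Continuous.subtype_mk (continuous_subtype_val (p := (· ∈ Z))) _), by
    have hc : Topology.IsClosedEmbedding fun z : Z => (⟨z.1, trivial⟩ : (Set.univ : Set X)) :=
      (Homeomorph.Set.univ X).symm.isClosedEmbedding.comp hZ.isClosedEmbedding_subtypeVal
    exact hc.isCompact_preimage s.2.2⟩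
  map_add' _ _ := rfl
  map_smul' _ _ := rfl

/-- Compactly supported sections over closed subsets of an `ℓ`-space extend. -/
lemma restrictSections_surjective [IsLSpace X] (hZ : IsClosed Z) :
    Function.Surjective (restrictSections F hZ) := by
  intro s
  have key : ∃ W : Clopens X, Subtype.val '' {z : Z | s.1 z ≠ 0} ⊆ W ∧
      ∃ t ∈ compactSections F Set.univ, ∀ z : Z, z.1 ∈ W → t ⟨z.1, trivial⟩ = s.1 z := by
    -- Agreement with `s` is asked only over `Z ∩ W`, which makes the claim stable under unions:
    -- take `t` on `W` and `t'` off `W`.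
    refine (s.2.2.image continuous_subtype_val).induction_on (p := fun S => ∃ W : Clopens X, S ⊆ W ∧
      ∃ t ∈ compactSections F Set.univ, ∀ z : Z, z.1 ∈ W → t ⟨z.1, trivial⟩ = s.1 z) ?_ ?_ ?_ ?_
    · exact ⟨⊥, Set.empty_subset _, 0, zero_mem _, fun z hz => hz.elim⟩
    · rintro S T hST ⟨W, hW, h⟩
      exact ⟨W, hST.trans hW, h⟩
    · rintro S T ⟨W, hW, t, ht, h⟩ ⟨W', hW', t', ht', h'⟩
      refine ⟨W ⊔ W', ?_, cutoff F _ W t + cutoff F _ (W : Set X)ᶜ t',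
        add_mem (cutoff_mem W.isClopen ht) (cutoff_mem W.isClopen.compl ht'), fun z hz => ?_⟩
      · rw [Clopens.coe_sup]
        exact Set.union_subset_union hW hW'
      · rw [Pi.add_apply]
        by_cases hzW : z.1 ∈ W
        · rw [cutoff_of_mem t (z := ⟨z.1, trivial⟩) hzW,
            cutoff_of_notMem t' (z := ⟨z.1, trivial⟩) (not_not.2 hzW), add_zero, h z hzW]
        · rw [cutoff_of_notMem t (z := ⟨z.1, trivial⟩) hzW,
            cutoff_of_mem t' (z := ⟨z.1, trivial⟩) hzW, zero_add, h' z (hz.resolve_left hzW)]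
    · rintro _ ⟨z₀, hz₀, rfl⟩
      obtain ⟨U, f, hf⟩ := LSh.exists_section s.2.1 z₀
      rw [nhds_subtype_eq_comap, Filter.eventually_comap] at hf
      obtain ⟨htU, -⟩ := hf.self_of_nhds z₀ rfl
      obtain ⟨D, hD, hzD⟩ := exists_compact_mem_nhds z₀.1
      -- Near `z₀` the section `s` is given by germs of some `f` on an open set `U` of `X`; `C` is a
      -- compact clopen neighborhood inside `U` on which this holds.
      obtain ⟨C, hC, hzC, hCU⟩ := (loc_compact_Haus_tot_disc_of_zero_dim (H := X)).mem_nhds_iff.1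
        (Filter.inter_mem (Filter.inter_mem hf hzD) (U.isOpen.mem_nhds htU))
      have hCc : IsCompact C := hD.of_isClosed_subset hC.isClosed fun x hx => (hCU hx).1.2
      have hCU' : ∀ x ∈ C, x ∈ U := fun x hx => (hCU hx).2
      classical
      let t : ∀ z : (Set.univ : Set X), F.Stalk z.1 := fun z =>
        if hz : z.1 ∈ U then F.presheaf.germ U z.1 hz f else 0
      have ht : Continuous fun z : (Set.univ : Set X) => F.pt z.1 (cutoff F _ C t z) := by
        refine continuous_cutoff hC ?_
        rw [continuousOn_iff_continuous_domRestrict]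
        refine LSh.continuous_of_section
          (T := {z : (Set.univ : Set X) | z.1 ∈ C}) (b := fun z => z.1.1) (by fun_prop)
          (s := fun z => t z.1) fun z => ⟨U, f, Filter.Eventually.of_forall fun w => ?_⟩
        exact ⟨hCU' _ w.2, dif_pos (hCU' _ w.2)⟩
      refine ⟨C, mem_nhdsWithin_of_mem_nhds (hC.isOpen.mem_nhds hzC), ⟨C, hC⟩, subset_rfl,
        cutoff F _ C t, ⟨ht, ?_⟩, fun z hz => ?_⟩
      · have hCc' : IsCompact {z : (Set.univ : Set X) | z.1 ∈ C} :=
          (Homeomorph.Set.univ X).isClosedEmbedding.isCompact_preimage hCc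
        refine hCc'.of_isClosed_subset (isClosed_support ht) fun z hz => ?_
        by_contra h
        exact hz (cutoff_of_notMem _ h)
      · have hzC : z.1 ∈ C := hz
        rw [cutoff_of_mem t (z := ⟨z.1, trivial⟩) hzC]
        obtain ⟨_, h⟩ := (hCU hz).1.1 z rfl
        rw [h]
        exact dif_pos (hCU' _ hz)
  obtain ⟨W, hW, t, ht, h⟩ := key
  -- Off `W` the cutoff vanishes, and so does `s`, whose support lies in `W`.
  refine ⟨⟨cutoff F _ W t, cutoff_mem W.isClopen ht⟩, Subtype.ext (funext fun z => ?_)⟩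
  show cutoff F _ W t ⟨z.1, trivial⟩ = s.1 z
  by_cases hz : z.1 ∈ W
  · rw [cutoff_of_mem t (z := ⟨z.1, trivial⟩) hz, h z hz]
  · rw [cutoff_of_notMem t (z := ⟨z.1, trivial⟩) hz]
    by_contra hne
    exact hz (hW ⟨z, fun h0 => hne h0.symm, rfl⟩)

variable {G : Type u} [Group G] [TopologicalSpace G] [IsTopologicalGroup G]
  [MulAction G X] [ContinuousSMul G X]

/-- Restriction of sections to a closed stable subset is equivariant. -/
noncomputable def restrictHom (α : EquivariantStructure G F) (hZc : IsClosed Z)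
    (hZ : IsStable G Z) :
    α.sections.obj.ρ.IntertwiningMap (α.sectionsOn hZ).obj.ρ where
  toLinearMap := restrictSections F hZc
  isIntertwining' _ := rfl

/-- Multiplication by the indicator function of a clopen stable subset is equivariant. -/
noncomputable def cutoffHom (α : EquivariantStructure G F) {C : Set X} (hC : IsClopen C)
    (hC' : ∀ (g : G) x, g • x ∈ C ↔ x ∈ C) :
    α.sections.obj.ρ.IntertwiningMap α.sections.obj.ρ where
  toLinearMap := (cutoff F Set.univ C).restrict fun _ hs => cutoff_mem hC hs
  isIntertwining' g := by
    refine LinearMap.ext fun s => Subtype.ext (funext fun z => ?_)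
    have hZ : IsStable G (Set.univ : Set X) := fun _ _ _ => trivial
    show cutoff F _ C (α.translate hZ g s.1) z = α.translate hZ g (cutoff F _ C s.1) z
    have hw := α.translate_eq hZ g (cutoff F _ C s.1) z ⟨g⁻¹ • z.1, trivial⟩ (smul_inv_smul _ _)
    rw [hw]
    by_cases hz : z.1 ∈ C
    · rw [cutoff_of_mem _ hz, cutoff_of_mem s.1 (z := ⟨g⁻¹ • z.1, trivial⟩) ((hC' _ _).2 hz)]
      rfl
    · rw [cutoff_of_notMem _ hz, cutoff_of_notMem s.1 (z := ⟨g⁻¹ • z.1, trivial⟩)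
        (fun h => hz ((hC' _ _).1 h)), map_zero]

/-- Injectivity on coinvariants for `Γ_c(F)` can be checked on the fibers of an invariant map. -/
theorem coinvariantsInjective_sections [IsLSpace X] {Y : Type u} [TopologicalSpace Y] [IsLSpace Y]
    (α : EquivariantStructure G F) {π : X → Y} (hπ : Continuous π)
    (hinv : ∀ (g : G) (x : X), π (g • x) = π x)
    {A B : Type u} [AddCommGroup A] [Module ℂ A] [AddCommGroup B] [Module ℂ B]
    {σ : Representation ℂ G A} {τ : Representation ℂ G B} (j : σ.IntertwiningMap τ)
    (h : ∀ y, CoinvariantsInjective (α.fiberSections hinv y).obj.ρ j) :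
    CoinvariantsInjective α.sections.obj.ρ j := by
  have hcl : ∀ y : Y, IsClosed (π ⁻¹' {y}) := fun y => isClosed_singleton.preimage hπ
  let e (U : Clopens Y) : α.sections.obj.ρ.IntertwiningMap α.sections.obj.ρ :=
    cutoffHom α (U.isClopen.preimage hπ) fun g x => by
      rw [Set.mem_preimage, hinv]; rfl
  have he : ∀ U (m : compactSections F Set.univ),
      (e U m : compactSections F Set.univ).1 = cutoff F _ (π ⁻¹' U) m.1 := fun U m => rfl
  have hcpt : ∀ m : compactSections F Set.univ,
      IsCompact (π '' (Subtype.val '' {z : (Set.univ : Set X) | m.1 z ≠ 0})) := fun m =>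
    (m.2.2.image continuous_subtype_val).image hπ
  refine coinvariantsInjective_of_stalks j (fun y => restrictHom α (hcl y) _)
    (fun y => restrictSections_surjective (hcl y)) e ?_ ?_ ?_ ?_ ?_ h
  · intro U V (m : compactSections F Set.univ)
    refine Subtype.ext (funext fun z => ?_)
    show cutoff F _ (π ⁻¹' ((U ⊔ V : Clopens Y) : Set Y)) m.1 z = cutoff F _ (π ⁻¹' U) m.1 z +
      cutoff F _ (π ⁻¹' ((Uᶜ : Clopens Y) : Set Y)) (cutoff F _ (π ⁻¹' V) m.1) z
    by_cases h1 : π z.1 ∈ U <;> by_cases h2 : π z.1 ∈ V <;>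
      simp [cutoff, h1, h2]
  · intro U V (m : compactSections F Set.univ) hUV
    refine Subtype.ext (funext fun z => ?_)
    show cutoff F _ (π ⁻¹' U) (cutoff F _ (π ⁻¹' V) m.1) z = cutoff F _ (π ⁻¹' U) m.1 z
    by_cases h1 : π z.1 ∈ U
    · have h2 : π z.1 ∈ V := hUV h1
      simp [cutoff, h1, h2]
    · simp [cutoff, h1]
  · intro U V (m : compactSections F Set.univ) hUV
    refine Subtype.ext (funext fun z => ?_)
    show cutoff F _ (π ⁻¹' V) (cutoff F _ (π ⁻¹' U) m.1) z = cutoff F _ (π ⁻¹' U) m.1 z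
    by_cases h1 : π z.1 ∈ U
    · have h2 : π z.1 ∈ V := hUV h1
      simp [cutoff, h1, h2]
    · simp [cutoff, h1]
  · intro y (m : compactSections F Set.univ) hm
    -- Vanishing on the fiber means that `y` avoids the image of the support, which is compact and
    -- hence closed; a clopen neighborhood of `y` then misses it.
    have hy : y ∉ π '' (Subtype.val '' {z : (Set.univ : Set X) | m.1 z ≠ 0}) := by
      rintro ⟨_, ⟨z, hz, rfl⟩, hzy⟩
      exact hz (congrFun (congrArg Subtype.val hm) ⟨z.1, hzy⟩)
    obtain ⟨C, hC, hyC, hCm⟩ := (loc_compact_Haus_tot_disc_of_zero_dim (H := Y)).mem_nhds_iff.1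
      ((hcpt m).isClosed.isOpen_compl.mem_nhds hy)
    refine ⟨⟨C, hC⟩, hyC, Subtype.ext (funext fun z => ?_)⟩
    show cutoff F _ (π ⁻¹' C) m.1 z = 0
    by_cases hz : π z.1 ∈ C
    · rw [cutoff_of_mem _ hz]
      by_contra h0
      exact hCm hz ⟨_, ⟨z, h0, rfl⟩, rfl⟩
    · rw [cutoff_of_notMem _ hz]
  · intro (m : compactSections F Set.univ)
    obtain ⟨W, hW, hmW⟩ := exists_compact_clopen_superset (hcpt m)
    refine ⟨W, hW, Subtype.ext (funext fun z => ?_)⟩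
    show cutoff F _ (π ⁻¹' W) m.1 z = m.1 z
    by_cases hz : π z.1 ∈ W
    · rw [cutoff_of_mem _ hz]
    · rw [cutoff_of_notMem _ hz]
      by_contra h0
      exact hz (hmW ⟨_, ⟨z, fun h => h0 h.symm, rfl⟩, rfl⟩)

end Sections

/-! ### Maps into a contragredient as functionals on coinvariants -/

section Contragredient

open Representation
open scoped TensorProduct

variable {G : Type u} [Group G] [TopologicalSpace G] [IsTopologicalGroup G]
variable {M A B W : Type u} [AddCommGroup M] [Module ℂ M] [AddCommGroup A] [Module ℂ A]
  [AddCommGroup B] [Module ℂ B] [AddCommGroup W] [Module ℂ W]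
  {ρ : Representation ℂ G M} {σ : Representation ℂ G A} {τ : Representation ℂ G B}
  {ω : Representation ℂ G W}

/-- An equivariant map `M ⊗ A → W^∨` gives an invariant functional on `M ⊗ (A ⊗ W)`. -/
lemma exists_functional_of_intertwiningMap
    (φ : (ρ.tprod σ).IntertwiningMap (smoothVectors ω.dual).toRepresentation) :
    ∃ l : M ⊗[ℂ] (A ⊗[ℂ] W) →ₗ[ℂ] ℂ,
      Coinvariants.ker (ρ.tprod (σ.tprod ω)) ≤ LinearMap.ker l ∧
      ∀ m a w, l (m ⊗ₜ (a ⊗ₜ w)) = (φ (m ⊗ₜ a)).1 w := by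
  let l : M ⊗[ℂ] (A ⊗[ℂ] W) →ₗ[ℂ] ℂ :=
    TensorProduct.lift ((smoothVectors ω.dual).toSubmodule.subtype ∘ₗ φ.toLinearMap) ∘ₗ
      (TensorProduct.assoc ℂ M A W).symm.toLinearMap
  have hl : ∀ m a w, l (m ⊗ₜ (a ⊗ₜ w)) = (φ (m ⊗ₜ a)).1 w := fun m a w => rfl
  refine ⟨l, Submodule.span_le.2 ?_, hl⟩
  rintro _ ⟨⟨g, x⟩, rfl⟩
  have hx : l ∘ₗ (ρ.tprod (σ.tprod ω)) g = l := by
    ext m a w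
    have h1 : φ (ρ g m ⊗ₜ σ g a) = _ := φ.isIntertwining _ _ g (m ⊗ₜ a)
    have h2 := LinearMap.congr_fun (congrArg Subtype.val h1) (ω g w)
    have h3 : ω g⁻¹ (ω g w) = w := by simp
    simp only [TensorProduct.AlgebraTensorModule.curry_apply, TensorProduct.curry_apply,
      LinearMap.coe_restrictScalars, LinearMap.comp_apply, Representation.tprod_apply, TensorProduct.map_tmul]
    rw [hl, hl, h2]
    show (φ (m ⊗ₜ a)).1 (ω g⁻¹ (ω g w)) = _
    rw [h3]
  show l ((ρ.tprod (σ.tprod ω)) g x - x) = 0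
  rw [map_sub, ← LinearMap.comp_apply, hx, sub_self]

/-- An invariant functional on `M ⊗ (A ⊗ W)` gives an equivariant map `M ⊗ A → W^∨`. -/
lemma exists_intertwiningMap_of_functional (hρ : IsSmooth ρ) (hσ : IsSmooth σ)
    (l : M ⊗[ℂ] (A ⊗[ℂ] W) →ₗ[ℂ] ℂ)
    (hl : Coinvariants.ker (ρ.tprod (σ.tprod ω)) ≤ LinearMap.ker l) :
    ∃ φ : (ρ.tprod σ).IntertwiningMap (smoothVectors ω.dual).toRepresentation,
      ∀ m a w, (φ (m ⊗ₜ a)).1 w = l (m ⊗ₜ (a ⊗ₜ w)) := by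
  have hinv : ∀ g x, l ((ρ.tprod (σ.tprod ω)) g x) = l x := fun g x => by
    rw [← sub_eq_zero, ← map_sub]
    exact hl (Coinvariants.sub_mem_ker g x)
  let f : (ρ.tprod σ).IntertwiningMap ω.dual :=
    { toLinearMap := TensorProduct.curry (l ∘ₗ (TensorProduct.assoc ℂ M A W).toLinearMap)
      isIntertwining' := fun g => by
        ext m a w
        have h := hinv g (m ⊗ₜ (a ⊗ₜ (ω g⁻¹ w)))
        simp only [Representation.tprod_apply, TensorProduct.map_tmul, self_inv_apply] at h
        exact h }
  -- Every vector of `M ⊗ A` is smooth, so an equivariant map to the full dual lands in its smooth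
  -- part.
  let φ : (ρ.tprod σ).IntertwiningMap (smoothVectors ω.dual).toRepresentation :=
    { toLinearMap := f.toLinearMap.codRestrict (smoothVectors ω.dual).toSubmodule
        fun x => IsSmoothVector.map f ((hρ.tprod hσ) x)
      isIntertwining' := fun g => LinearMap.ext fun x =>
        Subtype.ext (f.isIntertwining _ _ g x) }
  exact ⟨φ, fun m a w => rfl⟩

/-- Extension of equivariant maps into a contragredient, in terms of coinvariants. -/
theorem forall_exists_extension_iff (hρ : IsSmooth ρ) (hσ : IsSmooth σ) (hτ : IsSmooth τ)
    (j : σ.IntertwiningMap τ) :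
    (∀ φ : (ρ.tprod σ).IntertwiningMap (smoothVectors ω.dual).toRepresentation,
      ∃ φ' : (ρ.tprod τ).IntertwiningMap (smoothVectors ω.dual).toRepresentation,
        φ'.comp (j.lTensor ρ) = φ) ↔ CoinvariantsInjective ρ (j.rTensor ω) := by
  constructor
  · intro h c hc
    -- Functionals separate points of the coinvariants. Each one extends along `j` by hypothesis,
    -- hence vanishes on a class that dies in the target.
    rw [← Coinvariants.mk_eq_zero, ← Module.forall_dual_apply_eq_zero_iff ℂ]
    intro l
    obtain ⟨φ, hφ⟩ := exists_intertwiningMap_of_functional hρ hσ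
      (l ∘ₗ Coinvariants.mk (ρ.tprod (σ.tprod ω))) (fun x hx => by
        rw [LinearMap.mem_ker, LinearMap.comp_apply, (Coinvariants.mk_eq_zero _).2 hx, map_zero])
    obtain ⟨φ', rfl⟩ := h φ
    obtain ⟨l', hl', hlφ'⟩ := exists_functional_of_intertwiningMap φ'
    have key : l' ∘ₗ ((j.rTensor ω).lTensor ρ).toLinearMap =
        l ∘ₗ Coinvariants.mk (ρ.tprod (σ.tprod ω)) := by
      ext m a w
      exact (hlφ' m (j a) w).trans (hφ m a w)
    exact (LinearMap.congr_fun key c).symm.trans (hl' hc)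
  · intro h φ
    obtain ⟨l, hl, hlφ⟩ := exists_functional_of_intertwiningMap φ
    let ι := Coinvariants.map _ _ ((j.rTensor ω).lTensor ρ)
    have hι : LinearMap.ker ι = ⊥ := by
      rw [LinearMap.ker_eq_bot']
      intro x hx
      obtain ⟨c, rfl⟩ := Coinvariants.mk_surjective _ x
      rw [Coinvariants.map_mk, Coinvariants.mk_eq_zero] at hx
      exact (Coinvariants.mk_eq_zero _).2 (h c hx)
    -- Over a field the injection of coinvariants splits linearly; composing with the splitting
    -- extends the functional.
    obtain ⟨s, hs⟩ := LinearMap.exists_leftInverse_of_injective ι hι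
    let lbar : Coinvariants (ρ.tprod (σ.tprod ω)) →ₗ[ℂ] ℂ :=
      (Coinvariants.ker (ρ.tprod (σ.tprod ω))).liftQ l hl
    obtain ⟨φ', hφ'⟩ := exists_intertwiningMap_of_functional hρ hτ
      (lbar ∘ₗ s ∘ₗ Coinvariants.mk (ρ.tprod (τ.tprod ω))) (fun x hx => by
        rw [LinearMap.mem_ker, LinearMap.comp_apply, LinearMap.comp_apply,
          (Coinvariants.mk_eq_zero _).2 hx, map_zero, map_zero])
    refine ⟨φ', ?_⟩
    refine IntertwiningMap.ext ?_
    ext m a : 3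
    refine Subtype.ext (LinearMap.ext fun w => ?_)
    refine (hφ' m (j a) w).trans (Eq.trans ?_ (hlφ m a w))
    have h1 := LinearMap.congr_fun hs (Coinvariants.mk (ρ.tprod (σ.tprod ω)) (m ⊗ₜ (a ⊗ₜ w)))
    exact congrArg lbar h1

end Contragredient

/-! ### Exactness and projective objects among smooth representations -/

section Projective

variable {G : Type u} [Group G] [TopologicalSpace G]

/-- Short exactness of smooth representations is short exactness of vector spaces. -/
lemma SmoothRep.shortExact_of_exact (S : ShortComplex (SmoothRep G))
    (hf : Function.Injective S.f.hom.hom) (hg : Function.Surjective S.g.hom.hom)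
    (hfg : Function.Exact S.f.hom.hom S.g.hom.hom) : S.ShortExact := by
  have hm : Mono S.f := (smoothProp G).ι.mono_of_mono_map ((Rep.mono_iff_injective S.f.hom).2 hf)
  have he : Epi S.g := (smoothProp G).ι.epi_of_epi_map ((Rep.epi_iff_surjective S.g.hom).2 hg)
  refine { exact := S.exact_of_f_is_kernel ?_ }
  refine Limits.KernelFork.IsLimit.ofι' S.f S.zero fun {A} k hk => ?_
  have h1 : ∀ a, ∃ x, S.f.hom.hom x = k.hom.hom a := fun a =>
    (hfg _).1 (congrArg (fun t : A ⟶ S.X₃ => t.hom.hom a) hk)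
  -- The lift is chosen pointwise; injectivity of `S.f` forces it to be linear and equivariant.
  choose l hl using h1
  refine ⟨(smoothProp G).homMk (Rep.ofHom
    { toFun := l
      map_add' := fun a b => hf (by rw [map_add, hl, hl, hl, map_add])
      map_smul' := fun c a => hf (by rw [RingHom.id_apply, map_smul, hl, hl, map_smul])
      isIntertwining' := fun g => LinearMap.ext fun a => hf ?_ }), ?_⟩
  · show S.f.hom.hom (l (A.obj.ρ g a)) = S.f.hom.hom (S.X₁.obj.ρ g (l a))
    rw [hl, Rep.hom_comm_apply, Rep.hom_comm_apply, hl]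
  · apply ObjectProperty.hom_ext
    refine Rep.hom_ext (Representation.IntertwiningMap.ext (LinearMap.ext fun a => ?_))
    exact hl a

variable [IsTopologicalGroup G]

/-- The inclusion into all representations is a left adjoint, so it preserves epimorphisms. -/
lemma SmoothRep.surjective_of_epi {V W : SmoothRep G} (f : V ⟶ W) [Epi f] :
    Function.Surjective f.hom.hom := by
  have := (smoothPartAdj G).isLeftAdjoint
  exact (Rep.epi_iff_surjective ((smoothProp G).ι.map f)).1 inferInstance

/-- The smooth representation `ℂ[G/K]`. -/
noncomputable def SmoothRep.cosets {K : Subgroup G} (hK : IsOpen (K : Set G)) : SmoothRep G :=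
  ⟨Rep.of (cosetRep K), isSmooth_cosetRep hK⟩

/-- `V ⊗ ℂ[G/K]` is projective if `K` is a compact open subgroup. -/
lemma SmoothRep.projective_tensor_cosets {K : Subgroup G} (hK : IsOpen (K : Set G))
    (hK' : IsCompact (K : Set G)) (V : SmoothRep G) :
    Projective (V.tensor (SmoothRep.cosets hK)) where
  factors {E E'} f e _ := by
    let one : G ⧸ K →₀ ℂ := Finsupp.single ((1 : G) : G ⧸ K) 1
    have hone : ∀ g, cosetRep K g one = Finsupp.single (g : G ⧸ K) 1 := fun g =>
      cosetRep_single_one K g 1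
    -- Frobenius reciprocity: a map out of `V ⊗ ℂ[G/K]` is determined by its `K`-equivariant
    -- restriction to `V ⊗ [1]`, and such restrictions lift along surjections.
    let φ : V.obj →ₗ[ℂ] E'.obj :=
      f.hom.hom.toLinearMap ∘ₗ (TensorProduct.mk ℂ V.obj (G ⧸ K →₀ ℂ)).flip one
    have hφg : ∀ g v, V.obj.ρ.linHom E'.obj.ρ g φ v =
        f.hom.hom (v ⊗ₜ Finsupp.single (g : G ⧸ K) 1) := by
      intro g v
      have h := f.hom.hom.isIntertwining _ _ g (V.obj.ρ g⁻¹ v ⊗ₜ one)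
      rw [Representation.linHom_apply]
      refine h.symm.trans ?_
      show f.hom.hom (V.obj.ρ g (V.obj.ρ g⁻¹ v) ⊗ₜ cosetRep K g one) = _
      rw [hone, Representation.self_inv_apply]
    have hφ : ∀ k ∈ K, V.obj.ρ.linHom E'.obj.ρ k φ = φ := by
      intro k hk
      refine LinearMap.ext fun v => ?_
      rw [hφg]
      have : (k : G ⧸ K) = ((1 : G) : G ⧸ K) := by
        rw [QuotientGroup.eq, mul_one]
        exact K.inv_mem hk
      rw [this]
      rfl
    obtain ⟨ψ, hψ, hpψ⟩ := exists_equivariant_lift hK' V.property E.property e.hom.hom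
      (SmoothRep.surjective_of_epi e) φ hφ
    refine ⟨(smoothProp G).homMk (Rep.ofHom (uncurryHom (orbitMap _ ψ hψ))), ?_⟩
    apply ObjectProperty.hom_ext
    refine Rep.hom_ext (Representation.IntertwiningMap.ext ?_)
    refine TensorProduct.ext (LinearMap.ext fun v => Finsupp.lhom_ext' fun x => ?_)
    obtain ⟨g, rfl⟩ := QuotientGroup.mk_surjective x
    refine LinearMap.ext_ring ?_
    show e.hom.hom (orbitMap _ ψ hψ (Finsupp.single (g : G ⧸ K) 1) v) =
      f.hom.hom (v ⊗ₜ Finsupp.single (g : G ⧸ K) 1)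
    rw [orbitMap_single]
    refine Eq.trans ?_ (hφg g v)
    rw [Representation.linHom_apply, Representation.linHom_apply]
    refine (e.hom.hom.isIntertwining _ _ g _).trans ?_
    exact congrArg (E'.obj.ρ g) (LinearMap.congr_fun hpψ (V.obj.ρ g⁻¹ v))

end Projective

/-! ### Dimension shifting for Ext -/

section Ext

open Abelian

variable {C : Type*} [Category* C] [Abelian C] [HasExt.{u} C] {S : ShortComplex C}

/-- Since `Ext¹(X₂, Y) = 0`, the long exact sequence presents `Ext¹(X₃, Y)` as the cokernel of
restriction `Hom(X₂, Y) → Hom(X₁, Y)`. -/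
lemma subsingleton_ext_one_iff (hS : S.ShortExact) [Projective S.X₂] (Y : C) :
    Subsingleton (Ext.{u} S.X₃ Y 1) ↔ ∀ φ : S.X₁ ⟶ Y, ∃ φ' : S.X₂ ⟶ Y, S.f ≫ φ' = φ := by
  constructor
  · intro h φ
    obtain ⟨x, hx⟩ := Ext.contravariant_sequence_exact₁ hS Y (Ext.mk₀ φ) (n₁ := 1) rfl
      (Subsingleton.elim _ _)
    obtain ⟨φ', rfl⟩ := Ext.homEquiv₀.symm.surjective x
    refine ⟨φ', Ext.homEquiv₀.symm.injective ?_⟩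
    simpa using hx
  · intro h
    refine subsingleton_of_forall_eq 0 fun x => ?_
    obtain ⟨y, rfl⟩ := Ext.contravariant_sequence_exact₃ hS Y x
      (Ext.eq_zero_of_projective _) (n₀ := 0) rfl
    obtain ⟨φ, rfl⟩ := Ext.homEquiv₀.symm.surjective y
    obtain ⟨φ', rfl⟩ := h φ
    simp only [Ext.homEquiv₀_symm_apply]
    rw [← Ext.mk₀_comp_mk₀, ← Ext.comp_assoc_of_second_deg_zero, hS.extClass_comp, Ext.zero_comp]

/-- Both neighboring groups `Ext(X₂, Y)` have positive degree and vanish. The shift starts at degree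
two because `Hom(X₂, Y)` need not vanish. -/
lemma subsingleton_ext_succ_iff (hS : S.ShortExact) [Projective S.X₂] (Y : C) (n : ℕ) :
    Subsingleton (Ext.{u} S.X₃ Y (n + 2)) ↔ Subsingleton (Ext.{u} S.X₁ Y (n + 1)) := by
  constructor
  · intro h
    refine subsingleton_of_forall_eq 0 fun x => ?_
    obtain ⟨y, rfl⟩ := Ext.contravariant_sequence_exact₁ hS Y x (n₁ := n + 2) (by lia)
      (Subsingleton.elim _ _)
    rw [Ext.eq_zero_of_projective y, Ext.comp_zero]
  · intro h
    refine subsingleton_of_forall_eq 0 fun x => ?_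
    obtain ⟨y, rfl⟩ := Ext.contravariant_sequence_exact₃ hS Y x
      (Ext.eq_zero_of_projective _) (n₀ := n + 1) (by lia)
    rw [Subsingleton.elim y 0, Ext.comp_zero]

end Ext

/-! ### Syzygies and the fiberwise criterion for Ext -/

section DimensionShift

open Representation
open scoped TensorProduct

variable {G : Type u} [Group G] [TopologicalSpace G]

/-- The augmentation `V ⊗ ℂ[G/K] → V`. -/
noncomputable def augmentation (V : SmoothRep G) (K : Subgroup G) :
    (V.obj.ρ.tprod (cosetRep K)).IntertwiningMap V.obj.ρ where
  toLinearMap := (TensorProduct.rid ℂ V.obj).toLinearMap ∘ₗ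
    (Finsupp.linearCombination ℂ fun _ : G ⧸ K => (1 : ℂ)).lTensor V.obj
  isIntertwining' g := by
    ext v x
    simp

lemma augmentation_surjective (V : SmoothRep G) (K : Subgroup G) :
    Function.Surjective (augmentation V K) := fun v =>
  ⟨v ⊗ₜ Finsupp.single ((1 : G) : G ⧸ K) 1, by
    show TensorProduct.rid ℂ V.obj (v ⊗ₜ _) = v
    simp⟩

variable [IsTopologicalGroup G]

/-- The kernel of the augmentation `V ⊗ ℂ[G/K] → V`. -/
noncomputable def SmoothRep.syzygy (V : SmoothRep G) {K : Subgroup G} (hK : IsOpen (K : Set G)) :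
    SmoothRep G :=
  ⟨Rep.of (augmentation V K).ker.toRepresentation, fun v => by
    obtain ⟨U, hU, h⟩ := (V.tensor (SmoothRep.cosets hK)).property v.1
    exact ⟨U, hU, fun g hg => Subtype.ext (h g hg)⟩⟩

/-- The inclusion of the kernel of the augmentation. -/
noncomputable def syzygyInclusion (V : SmoothRep G) {K : Subgroup G} (hK : IsOpen (K : Set G)) :
    (V.syzygy hK).obj.ρ.IntertwiningMap (V.tensor (SmoothRep.cosets hK)).obj.ρ where
  toLinearMap := (augmentation V K).ker.toSubmodule.subtype
  isIntertwining' _ := rfl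

/-- The short exact sequence `0 → M ⊗ A → M ⊗ (V ⊗ ℂ[G/K]) → M ⊗ V → 0`, where `A` is the kernel
of the augmentation. -/
noncomputable def syzygySequence (M V : SmoothRep G) {K : Subgroup G}
    (hK : IsOpen (K : Set G)) : ShortComplex (SmoothRep G) where
  X₁ := M.tensor (V.syzygy hK)
  X₂ := M.tensor (V.tensor (SmoothRep.cosets hK))
  X₃ := M.tensor V
  f := (smoothProp G).homMk (Rep.ofHom ((syzygyInclusion V hK).lTensor M.obj.ρ))
  g := (smoothProp G).homMk (Rep.ofHom ((augmentation V K).lTensor M.obj.ρ))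
  zero := by
    apply ObjectProperty.hom_ext
    refine Rep.hom_ext (Representation.IntertwiningMap.ext ?_)
    refine TensorProduct.ext' fun m a => ?_
    show m ⊗ₜ[ℂ] (augmentation V K a.1) = 0
    rw [show augmentation V K a.1 = 0 from a.2, TensorProduct.tmul_zero]

lemma syzygySequence_shortExact (M V : SmoothRep G) {K : Subgroup G}
    (hK : IsOpen (K : Set G)) : (syzygySequence M V hK).ShortExact := by
  have hex : Function.Exact (augmentation V K).ker.toSubmodule.subtype
      (augmentation V K).toLinearMap := LinearMap.exact_subtype_ker_map _
  refine SmoothRep.shortExact_of_exact _ ?_ ?_ ?_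
  · exact Module.Flat.lTensor_preserves_injective_linearMap (M := M.obj)
      (augmentation V K).ker.toSubmodule.subtype (Submodule.injective_subtype _)
  · exact LinearMap.lTensor_surjective M.obj (augmentation_surjective V K)
  · exact lTensor_exact M.obj hex (augmentation_surjective V K)

/-- Reassociating, the middle term is `(M ⊗ V) ⊗ ℂ[G/K]`. -/
lemma projective_syzygySequence (M V : SmoothRep G) {K : Subgroup G}
    (hK : IsOpen (K : Set G)) (hK' : IsCompact (K : Set G)) :
    Projective (syzygySequence M V hK).X₂ := by
  have := SmoothRep.projective_tensor_cosets hK hK' (M.tensor V)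
  let e := Rep.mkIso (Representation.TensorProduct.assoc M.obj.ρ V.obj.ρ (cosetRep K))
  let e' : (M.tensor V).tensor (SmoothRep.cosets hK) ≅ (syzygySequence M V hK).X₂ :=
    { hom := (smoothProp G).homMk e.hom
      inv := (smoothProp G).homMk e.inv
      hom_inv_id := ObjectProperty.hom_ext _ e.hom_inv_id
      inv_hom_id := ObjectProperty.hom_ext _ e.inv_hom_id }
  exact Projective.of_iso e' this

/-- Vanishing of `Hom(M ⊗ V, W^∨)` in terms of coinvariants. -/
lemma subsingleton_ext_zero_iff_coinvariantsInjective (M V W : SmoothRep G) :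
    Subsingleton (Abelian.Ext (M.tensor V) W.contragredient 0) ↔
      CoinvariantsInjective M.obj.ρ
        ((0 : V.obj.ρ.IntertwiningMap (Representation.trivial ℂ G PUnit.{u + 1})).rTensor
          W.obj.ρ) := by
  -- With `j` the zero map to a zero representation, extendability of every map says that every map
  -- is zero, which puts degree zero in the same form as degree one.
  rw [Abelian.Ext.homEquiv₀.subsingleton_congr, ← forall_exists_extension_iff M.property V.property
    (fun v => ⟨⊤, isOpen_univ, fun g _ => rfl⟩)]
  constructor
  · intro h φ
    refine ⟨0, ?_⟩
    have h1 := h.elim ((smoothProp G).homMk (Rep.ofHom φ)) 0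
    exact (congrArg (fun t : M.tensor V ⟶ W.contragredient => t.hom.hom) h1).symm
  · intro h
    refine subsingleton_of_forall_eq 0 fun f => ?_
    obtain ⟨φ', hφ'⟩ := h f.hom.hom
    apply ObjectProperty.hom_ext
    refine Rep.hom_ext (hφ'.symm.trans ?_)
    rw [IntertwiningMap.lTensor_zero]
    refine Representation.IntertwiningMap.ext (LinearMap.ext fun x => ?_)
    exact map_zero φ'

/-- Vanishing of `Ext¹(M ⊗ V, W^∨)` in terms of coinvariants. -/
lemma subsingleton_ext_one_iff_coinvariantsInjective (M V W : SmoothRep G) {K : Subgroup G}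
    (hK : IsOpen (K : Set G)) (hK' : IsCompact (K : Set G)) :
    Subsingleton (Abelian.Ext (M.tensor V) W.contragredient 1) ↔
      CoinvariantsInjective M.obj.ρ ((syzygyInclusion V hK).rTensor W.obj.ρ) := by
  have := projective_syzygySequence M V hK hK'
  refine (subsingleton_ext_one_iff (syzygySequence_shortExact M V hK) W.contragredient).trans ?_
  rw [← forall_exists_extension_iff M.property (V.syzygy hK).property
    (V.tensor (SmoothRep.cosets hK)).property]
  constructor
  · intro h φ
    obtain ⟨φ', hφ'⟩ := h ((smoothProp G).homMk (Rep.ofHom φ))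
    exact ⟨φ'.hom.hom,
      congrArg (fun t : (syzygySequence M V hK).X₁ ⟶ W.contragredient => t.hom.hom) hφ'⟩
  · intro h φ
    obtain ⟨φ', hφ'⟩ := h φ.hom.hom
    refine ⟨(smoothProp G).homMk (Rep.ofHom φ'), ?_⟩
    apply ObjectProperty.hom_ext
    exact Rep.hom_ext hφ'

variable {X Y : Type u} [LSheaf.IsLSpace G]
    [TopologicalSpace X] [LSheaf.IsLSpace X] [MulAction G X] [ContinuousSMul G X]
    [TopologicalSpace Y] [LSheaf.IsLSpace Y]

/-- Vanishing of `Ext^n(Γ_c(F) ⊗ V, W^∨)` can be checked on the fibers of an invariant map. -/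
theorem subsingleton_ext_sections {F : LSh X} (α : EquivariantStructure G F)
    {π : X → Y} (hπ : Continuous π) (hinv : ∀ (g : G) (x : X), π (g • x) = π x)
    (W : SmoothRep G) (n : ℕ) (V : SmoothRep G)
    (h : ∀ y, Subsingleton
      (Abelian.Ext ((α.fiberSections hinv y).tensor V) W.contragredient n)) :
    Subsingleton (Abelian.Ext (α.sections.tensor V) W.contragredient n) := by
  obtain ⟨K, hK, hK'⟩ := exists_isCompact_isOpen_subgroup (G := G)
  -- `V` must vary, since the shift replaces it by its syzygy; that syzygy does not involve `F`, so
  -- the fiber hypotheses pass to it unchanged in form.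
  induction n generalizing V with
  | zero =>
    simp only [subsingleton_ext_zero_iff_coinvariantsInjective] at h ⊢
    exact coinvariantsInjective_sections α hπ hinv _ h
  | succ n ih =>
    cases n with
    | zero =>
      simp only [zero_add, subsingleton_ext_one_iff_coinvariantsInjective _ _ _ hK hK'] at h ⊢
      exact coinvariantsInjective_sections α hπ hinv _ h
    | succ n =>
      have := projective_syzygySequence α.sections V hK hK'
      refine (subsingleton_ext_succ_iff (syzygySequence_shortExact _ V hK) _ n).2
        (ih (V.syzygy hK) fun y => ?_)
      have := projective_syzygySequence (α.fiberSections hinv y) V hK hK'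
      exact (subsingleton_ext_succ_iff (syzygySequence_shortExact _ V hK) _ n).1 (h y)

end DimensionShift

/-! ### Generalized invariants and compact subgroups -/

section GenInvariants

variable {G : Type u} [Group G] {V W : Type u} [AddCommGroup V] [Module ℂ V]
  [AddCommGroup W] [Module ℂ W]

/-- The operator `(g₀ - 1)(g₁ - 1)⋯(g_k - 1)` of a representation. -/
abbrev prodSubOne (ρ : Representation ℂ G V) {k : ℕ} (g : Fin (k + 1) → G) : Module.End ℂ V :=
  (List.ofFn fun j => ρ (g j) - 1).prod

lemma map_prodSubOne {ρ : Representation ℂ G V} {σ : Representation ℂ G W}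
    (f : ρ.IntertwiningMap σ) {k : ℕ} (g : Fin (k + 1) → G) (v : V) :
    f (prodSubOne ρ g v) = prodSubOne σ g (f v) := by
  have key : ∀ (l : List G) (v : V), f ((l.map fun a => ρ a - 1).prod v) =
      (l.map fun a => σ a - 1).prod (f v) := by
    intro l
    induction l with
    | nil => intro v; rfl
    | cons a l ih =>
      intro v
      simp only [List.map_cons, List.prod_cons, Module.End.mul_apply, LinearMap.sub_apply,
        Module.End.one_apply, map_sub, ih, f.isIntertwining]
  have h1 := key (List.ofFn g) v
  rwa [List.map_ofFn, List.map_ofFn] at h1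

lemma apply_prodSubOne (ρ : Representation ℂ G V) (h : G) {k : ℕ} (g : Fin (k + 1) → G) (v : V) :
    ρ h (prodSubOne ρ g v) = prodSubOne ρ (fun j => h * g j * h⁻¹) (ρ h v) := by
  have key : ∀ (l : List G) (v : V), ρ h ((l.map fun a => ρ a - 1).prod v) =
      (l.map fun a => ρ (h * a * h⁻¹) - 1).prod (ρ h v) := by
    intro l
    induction l with
    | nil => intro v; rfl
    | cons a l ih =>
      intro v
      have h1 : ∀ w, ρ (h * a * h⁻¹) (ρ h w) = ρ h (ρ a w) := by simp
      simp only [List.map_cons, List.prod_cons, Module.End.mul_apply, LinearMap.sub_apply,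
        Module.End.one_apply, map_sub, ← ih, h1]
  have h1 := key (List.ofFn g) v
  rwa [List.map_ofFn, List.map_ofFn] at h1

/-- Conjugation by `h` only permutes the tuples `(g₀, …, g_k)`. -/
lemma apply_mem_genInvariants {ρ : Representation ℂ G V} {k : ℕ} {v : V}
    (hv : v ∈ genInvariants ρ k) (h : G) : ρ h v ∈ genInvariants ρ k := by
  intro g
  have h1 := apply_prodSubOne ρ h (fun j => h⁻¹ * g j * h) v
  have h2 : prodSubOne ρ (fun j => h⁻¹ * g j * h) v = 0 := hv _
  rw [h2, map_zero] at h1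
  have h3 : (fun j => h * (h⁻¹ * g j * h) * h⁻¹) = g := by
    funext j
    group
  rw [h3] at h1
  exact h1.symm

variable [TopologicalSpace G] [IsTopologicalGroup G]

/-- Generalized homomorphisms of smooth representations are equivariant under
compact subgroups. -/
lemma linHom_apply_of_mem_genInvariants {K : Subgroup G} (hK : IsCompact (K : Set G))
    {ρ : Representation ℂ G V} {σ : Representation ℂ G W} (hρ : IsSmooth ρ) (hσ : IsSmooth σ)
    {k : ℕ} {φ : V →ₗ[ℂ] W} (hφ : φ ∈ genInvariants (ρ.linHom σ) k) {g : G} (hg : g ∈ K) :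
    ρ.linHom σ g φ = φ := by
  let T := ρ.linHom σ g
  -- If `(T - 1)²ψ = 0` then `T^m ψ = ψ + m(T - 1)ψ`. For given `v`, some `g^m` with `m > 0` fixes
  -- both `v` and `ψ v`, so `m(T - 1)ψ` vanishes at `v`.
  have step : ∀ ψ, (T - 1) ((T - 1) ψ) = 0 → (T - 1) ψ = 0 := by
    intro ψ hψ
    have hpow : ∀ m : ℕ, (T ^ m) ψ = ψ + (m : ℂ) • (T - 1) ψ := by
      intro m
      induction m with
      | zero => simp
      | succ m ih =>
        have h1 : T ((T - 1) ψ) = (T - 1) ψ := sub_eq_zero.1 hψ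
        have h2 : T ψ = ψ + (T - 1) ψ := by simp
        rw [pow_succ', Module.End.mul_apply, ih, map_add, map_smul, h1, h2]
        push_cast
        rw [add_smul, one_smul]
        abel
    refine LinearMap.ext fun v => ?_
    obtain ⟨A, hA, hA'⟩ := hρ v
    obtain ⟨B, hB, hB'⟩ := hσ (ψ v)
    obtain ⟨m, hm, hmg⟩ := exists_pow_mem hK (U := A ⊓ B) (hA.inter hB) hg
    have h1 : (T ^ m) ψ v = ψ v := by
      show ((ρ.linHom σ g) ^ m) ψ v = ψ v
      rw [← map_pow, Representation.linHom_apply, LinearMap.comp_apply, LinearMap.comp_apply,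
        hA' _ (A.inv_mem hmg.1), hB' _ hmg.2]
    rw [hpow m, LinearMap.add_apply, add_eq_left, LinearMap.smul_apply, smul_eq_zero] at h1
    exact h1.resolve_left (by exact_mod_cast hm.ne')
  have hall : ∀ n : ℕ, ((T - 1) ^ (n + 1)) φ = 0 → (T - 1) φ = 0 := by
    intro n
    induction n with
    | zero => intro h; simpa using h
    | succ n ih =>
      intro h
      refine ih ?_
      rw [pow_succ', Module.End.mul_apply]
      refine step _ ?_
      rwa [pow_succ', pow_succ', Module.End.mul_apply, Module.End.mul_apply] at h
  -- The constant tuple gives `(T - 1)^(k + 1) φ = 0`, and the exponent is then lowered to one.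
  have h0 := hφ fun _ => g
  rw [List.ofFn_const, List.prod_replicate] at h0
  exact sub_eq_zero.1 (hall k h0)

end GenInvariants

/-! ### Representing generalized homomorphisms -/

section Representing

open scoped TensorProduct

variable {G : Type u} [Group G]

/-- The submodule of `ℂ[G/K]` spanned by the elements `(g₀ - 1)⋯(g_k - 1) x`. -/
noncomputable def augmentationPower (K : Subgroup G) (k : ℕ) : Submodule ℂ (G ⧸ K →₀ ℂ) :=
  Submodule.span ℂ (Set.range fun p : (Fin (k + 1) → G) × (G ⧸ K →₀ ℂ) =>
    prodSubOne (cosetRep K) p.1 p.2)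

lemma augmentationPower_le_comap (K : Subgroup G) (k : ℕ) (h : G) :
    augmentationPower K k ≤ (augmentationPower K k).comap (cosetRep K h) := by
  refine Submodule.span_le.2 ?_
  rintro _ ⟨⟨g, x⟩, rfl⟩
  show cosetRep K h (prodSubOne (cosetRep K) g x) ∈ augmentationPower K k
  rw [apply_prodSubOne]
  exact Submodule.subset_span ⟨(_, _), rfl⟩

/-- The quotient of `ℂ[G/K]` by the elements `(g₀ - 1)⋯(g_k - 1) x`. -/
noncomputable abbrev truncatedRep (K : Subgroup G) (k : ℕ) :
    Representation ℂ G ((G ⧸ K →₀ ℂ) ⧸ augmentationPower K k) :=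
  (cosetRep K).quotient (augmentationPower K k) (augmentationPower_le_comap K k)

/-- The projection from `ℂ[G/K]` to its quotient. -/
noncomputable def truncatedRepMk (K : Subgroup G) (k : ℕ) :
    (cosetRep K).IntertwiningMap (truncatedRep K k) where
  toLinearMap := (augmentationPower K k).mkQ
  isIntertwining' _ := rfl

variable [TopologicalSpace G] [IsTopologicalGroup G]

/-- The smooth representation `ℂ[G/K] / ⟨(g₀ - 1)⋯(g_k - 1) x⟩`, which represents generalized
homomorphisms. -/
noncomputable def SmoothRep.truncated {K : Subgroup G} (hK : IsOpen (K : Set G)) (k : ℕ) :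
    SmoothRep G :=
  ⟨Rep.of (truncatedRep K k), fun v => by
    obtain ⟨x, rfl⟩ := Submodule.mkQ_surjective _ v
    exact (isSmooth_cosetRep hK x).map (truncatedRepMk K k)⟩

variable {K : Subgroup G} (hK : IsOpen (K : Set G)) {k : ℕ} {V W W' : SmoothRep G}

/-- The equivariant map `ℂ[G/K] → Hom(V, W)` given by a map on `V ⊗ ℂ[G/K] / ⟨⋯⟩`. -/
noncomputable def curryTruncated (f : V.tensor (SmoothRep.truncated hK k) ⟶ W) :
    (cosetRep K).IntertwiningMap (V.obj.ρ.linHom W.obj.ρ) where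
  toLinearMap := (TensorProduct.curry f.hom.hom.toLinearMap).flip ∘ₗ
    (truncatedRepMk K k).toLinearMap
  isIntertwining' g := by
    refine LinearMap.ext fun x => LinearMap.ext fun v => ?_
    have h := f.hom.hom.isIntertwining _ _ g (V.obj.ρ g⁻¹ v ⊗ₜ truncatedRepMk K k x)
    refine Eq.trans ?_ h
    show f.hom.hom (v ⊗ₜ truncatedRepMk K k (cosetRep K g x)) =
      f.hom.hom (V.obj.ρ g (V.obj.ρ g⁻¹ v) ⊗ₜ truncatedRep K k g (truncatedRepMk K k x))
    rw [Representation.self_inv_apply]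
    rfl

lemma curryTruncated_apply (f : V.tensor (SmoothRep.truncated hK k) ⟶ W) (x : G ⧸ K →₀ ℂ)
    (v : V.obj) : curryTruncated hK f x v = f.hom.hom (v ⊗ₜ truncatedRepMk K k x) := rfl

/-- The coset of the identity, as an element of `ℂ[G/K]`. -/
noncomputable abbrev oneCoset (K : Subgroup G) : G ⧸ K →₀ ℂ := Finsupp.single ((1 : G) : G ⧸ K) 1

/-- The linear map `V → W` attached to a morphism `V ⊗ ℂ[G/K] / ⟨⋯⟩ → W`. -/
noncomputable def genHomOf (f : V.tensor (SmoothRep.truncated hK k) ⟶ W) : V.obj →ₗ[ℂ] W.obj :=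
  curryTruncated hK f (oneCoset K)

lemma genHomOf_mem (f : V.tensor (SmoothRep.truncated hK k) ⟶ W) :
    genHomOf hK f ∈ genHom k V W := by
  intro g
  refine (map_prodSubOne (curryTruncated hK f) g (oneCoset K)).symm.trans ?_
  refine LinearMap.ext fun v => ?_
  rw [curryTruncated_apply]
  have h : truncatedRepMk K k (prodSubOne (cosetRep K) g (oneCoset K)) = 0 :=
    (Submodule.Quotient.mk_eq_zero _).2 (Submodule.subset_span ⟨(g, oneCoset K), rfl⟩)
  rw [h]
  exact (congrArg f.hom.hom (TensorProduct.tmul_zero _ v)).trans (map_zero _)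

/-- Naturality in `W`, needed to compare the two Hom complexes of an injective resolution. -/
lemma genHomOf_comp (f : V.tensor (SmoothRep.truncated hK k) ⟶ W) (u : W ⟶ W') :
    genHomOf hK (f ≫ u) = u.hom.hom.toLinearMap ∘ₗ genHomOf hK f := rfl

/-- The identity coset generates `ℂ[G/K]` as a representation. -/
lemma genHomOf_injective :
    Function.Injective (genHomOf hK : (V.tensor (SmoothRep.truncated hK k) ⟶ W) → _) := by
  intro f f' h
  have h1 : (curryTruncated hK f).toLinearMap = (curryTruncated hK f').toLinearMap := by
    refine Finsupp.lhom_ext' fun x => LinearMap.ext_ring ?_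
    obtain ⟨g, rfl⟩ := QuotientGroup.mk_surjective x
    show curryTruncated hK f (Finsupp.single (g : G ⧸ K) 1) =
      curryTruncated hK f' (Finsupp.single (g : G ⧸ K) 1)
    rw [← cosetRep_single_one]
    refine ((curryTruncated hK f).isIntertwining _ _ g _).trans
      (Eq.trans ?_ ((curryTruncated hK f').isIntertwining _ _ g _).symm)
    exact congrArg _ h
  apply ObjectProperty.hom_ext
  refine Rep.hom_ext (Representation.IntertwiningMap.ext (TensorProduct.ext' fun v a => ?_))
  obtain ⟨x, rfl⟩ := Submodule.mkQ_surjective _ a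
  exact LinearMap.congr_fun (LinearMap.congr_fun h1 x) v

/-- Compactness of `K` makes `φ` fixed by `K`, so it has an orbit map from `ℂ[G/K]`. Its image stays
in the `G`-stable space `genHom k V W`, so it kills all `(g₀ - 1)⋯(g_k - 1)x`. -/
lemma exists_genHomOf_eq (hK' : IsCompact (K : Set G)) {φ : V.obj →ₗ[ℂ] W.obj}
    (hφ : φ ∈ genHom k V W) :
    ∃ f : V.tensor (SmoothRep.truncated hK k) ⟶ W, genHomOf hK f = φ := by
  let o : (cosetRep K).IntertwiningMap (V.obj.ρ.linHom W.obj.ρ) := orbitMap _ φ fun g hg =>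
    linHom_apply_of_mem_genInvariants hK' V.property W.property hφ hg
  have ho1 : ∀ g : G, o (Finsupp.single (g : G ⧸ K) 1) = V.obj.ρ.linHom W.obj.ρ g φ :=
    orbitMap_single _ _ _
  have ho2 : ∀ x, o x ∈ genHom k V W := by
    intro x
    induction x using Finsupp.induction_linear with
    | zero => rw [map_zero]; exact zero_mem _
    | add x y hx hy => rw [map_add]; exact add_mem hx hy
    | single x c =>
      obtain ⟨g, rfl⟩ := QuotientGroup.mk_surjective x
      have : Finsupp.single (g : G ⧸ K) c = c • Finsupp.single (g : G ⧸ K) (1 : ℂ) := by simp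
      rw [this, map_smul, ho1]
      exact Submodule.smul_mem _ _ (apply_mem_genInvariants hφ g)
  have ho3 : augmentationPower K k ≤ LinearMap.ker o.toLinearMap := by
    refine Submodule.span_le.2 ?_
    rintro _ ⟨⟨g, x⟩, rfl⟩
    exact (map_prodSubOne o g x).trans (ho2 x g)
  let L : (truncatedRep K k).IntertwiningMap (V.obj.ρ.linHom W.obj.ρ) :=
    { toLinearMap := (augmentationPower K k).liftQ o.toLinearMap ho3
      isIntertwining' := fun g => by
        refine Submodule.linearMap_qext _ (LinearMap.ext fun x => ?_)
        exact o.isIntertwining _ _ g x }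
  refine ⟨(smoothProp G).homMk (Rep.ofHom (uncurryHom L)), ?_⟩
  refine Eq.trans (b := o (oneCoset K)) rfl ?_
  rw [ho1, map_one]
  rfl

end Representing

/-! ### Comparison of the two Ext groups -/

section GenExt

variable {G : Type u} [Group G] [TopologicalSpace G] [IsTopologicalGroup G]

/-- Vanishing of right derived functors of `Hom_{G,k}(V, ·)` in terms of an injective resolution. -/
lemma subsingleton_rightDerived_genHomFunctor_iff (k : ℕ) (V W : SmoothRep G)
    (R : InjectiveResolution W) (n p : ℕ) (hp : (ComplexShape.up ℕ).prev n = p) :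
    Subsingleton (((genHomFunctor k V).rightDerived n).obj W) ↔
      ∀ φ ∈ genHom k V (R.cocomplex.X n),
        (R.cocomplex.d n (n + 1)).hom.hom.toLinearMap ∘ₗ φ = 0 →
        ∃ ψ ∈ genHom k V (R.cocomplex.X p),
          (R.cocomplex.d p n).hom.hom.toLinearMap ∘ₗ ψ = φ := by
  rw [← ModuleCat.isZero_iff_subsingleton,
    (R.isoRightDerivedObj (genHomFunctor k V) n).isZero_iff]
  refine (HomologicalComplex.exactAt_iff_isZero_homology _ n).symm.trans ?_
  rw [HomologicalComplex.exactAt_iff' _ p n (n + 1) hp (by simp),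
    ShortComplex.moduleCat_exact_iff]
  constructor
  · intro h φ hφ h0
    obtain ⟨ψ, hψ⟩ := h ⟨φ, hφ⟩ (Subtype.ext h0)
    exact ⟨ψ.1, ψ.2, congrArg Subtype.val hψ⟩
  · intro h φ h0
    obtain ⟨ψ, hψ, h1⟩ := h φ.1 φ.2 (congrArg Subtype.val h0)
    exact ⟨⟨ψ, hψ⟩, Subtype.ext h1⟩

/-- `Ext_{G,k}(V, W)` vanishes if and only if `Ext_G(V ⊗ ℂ[G/K] / ⟨⋯⟩, W)` does. -/
theorem subsingleton_genExt_iff {K : Subgroup G} (hK : IsOpen (K : Set G))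
    (hK' : IsCompact (K : Set G)) (k : ℕ) (V W : SmoothRep G) (n : ℕ) :
    Subsingleton (((genHomFunctor k V).rightDerived n).obj W) ↔
      Subsingleton (Abelian.Ext (V.tensor (SmoothRep.truncated hK k)) W n) := by
  let R := InjectiveResolution.of W
  have hcomp : ∀ {p q : ℕ} (f : V.tensor (SmoothRep.truncated hK k) ⟶ R.cocomplex.X p)
      (f' : V.tensor (SmoothRep.truncated hK k) ⟶ R.cocomplex.X q),
      (R.cocomplex.d p q).hom.hom.toLinearMap ∘ₗ genHomOf hK f = genHomOf hK f' ↔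
        f ≫ R.cocomplex.d p q = f' := fun f f' => by
    rw [← genHomOf_comp, (genHomOf_injective hK).eq_iff]
  cases n with
  | zero =>
    rw [subsingleton_rightDerived_genHomFunctor_iff k V W R 0 0 CochainComplex.prev_nat_zero,
      Abelian.Ext.homEquiv₀.subsingleton_congr]
    -- The predecessor of `0` is `0` by convention, with zero differential, so being a boundary in
    -- degree zero means being zero.
    have hd : R.cocomplex.d 0 0 = 0 := R.cocomplex.shape _ _ (by simp)
    let i : W ⟶ R.cocomplex.X 0 := R.ι.f 0
    have hi : i ≫ R.cocomplex.d 0 1 = 0 := R.ι_f_zero_comp_complex_d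
    have : Mono i := inferInstanceAs (Mono (R.ι.f 0))
    constructor
    · intro h
      refine subsingleton_of_forall_eq 0 fun f => ?_
      obtain ⟨ψ, -, h1⟩ := h (genHomOf hK (f ≫ i)) (genHomOf_mem hK _)
        ((hcomp _ 0).2 (by rw [Category.assoc, hi, Limits.comp_zero]))
      rw [hd] at h1
      have h2 : f ≫ i = 0 := genHomOf_injective hK (h1.symm.trans rfl)
      rw [← cancel_mono i, h2, Limits.zero_comp]
    · intro h φ hφ h0
      obtain ⟨f, rfl⟩ := exists_genHomOf_eq hK hK' hφ
      have h1 : f ≫ R.cocomplex.d 0 1 = 0 := (hcomp f 0).1 h0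
      obtain ⟨l, hl⟩ := Limits.KernelFork.IsLimit.lift' R.isLimitKernelFork f h1
      have hf : f = 0 := hl.symm.trans
        ((congrArg (fun t : V.tensor (SmoothRep.truncated hK k) ⟶ W => t ≫ i)
          (h.elim l 0)).trans Limits.zero_comp)
      refine ⟨0, zero_mem _, ?_⟩
      rw [hf, LinearMap.comp_zero]
      rfl
  | succ n =>
    rw [subsingleton_rightDerived_genHomFunctor_iff k V W R (n + 1) n
      (CochainComplex.prev_nat_succ n)]
    constructor
    · intro h
      refine subsingleton_of_forall_eq 0 fun x => ?_
      -- Classes in degree `n + 1` are cocycles into the resolution, trivial exactly when they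
      -- factor through the preceding differential.
      obtain ⟨f, hf, rfl⟩ := R.extMk_surjective x (n + 2) rfl
      rw [R.extMk_eq_zero_iff f (n + 2) rfl hf n rfl]
      obtain ⟨ψ, hψ, h1⟩ := h (genHomOf hK f) (genHomOf_mem hK f) ((hcomp f 0).2 hf)
      obtain ⟨f', rfl⟩ := exists_genHomOf_eq hK hK' hψ
      exact ⟨f', (hcomp f' f).1 h1⟩
    · intro h φ hφ h0
      obtain ⟨f, rfl⟩ := exists_genHomOf_eq hK hK' hφ
      have hf := (hcomp f 0).1 h0
      obtain ⟨f', hf'⟩ := (R.extMk_eq_zero_iff f (n + 2) rfl hf n rfl).1 (h.elim _ _)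
      exact ⟨genHomOf hK f', genHomOf_mem hK f', (hcomp f' f).2 hf'⟩

end GenExt

/-! ### Characters as contragredients -/

section Character

variable {G : Type u} [Group G] [TopologicalSpace G] [IsTopologicalGroup G]

/-- A character is the contragredient of its inverse. -/
noncomputable def ofCharIsoContragredient (χ : G →* ℂˣ) (hχ : IsLocallyConstant χ)
    (hχ' : IsLocallyConstant (χ⁻¹ : G →* ℂˣ)) :
    SmoothRep.ofChar χ hχ ≅ (SmoothRep.ofChar χ⁻¹ hχ').contragredient where
  hom := (smoothPartAdj G).homEquiv _ _ (Rep.ofHom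
    { toLinearMap := (LinearMap.mul ℂ ℂ).compl₁₂ ULift.moduleEquiv.toLinearMap
        ULift.moduleEquiv.toLinearMap
      isIntertwining' := fun g => by
        refine LinearMap.ext fun z => LinearMap.ext fun w => ?_
        show (((χ g : ℂˣ) : ℂ) * z.down) * w.down =
          z.down * ((((χ⁻¹ : G →* ℂˣ) g⁻¹ : ℂˣ) : ℂ) * w.down)
        rw [MonoidHom.inv_apply, map_inv, inv_inv]
        ring })
  inv := (smoothProp G).homMk (Rep.ofHom
    { toLinearMap := ULift.moduleEquiv.symm.toLinearMap ∘ₗ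
        LinearMap.applyₗ (ULift.up (1 : ℂ)) ∘ₗ (smoothVectors _).toSubmodule.subtype
      isIntertwining' := fun g => by
        refine LinearMap.ext fun f => ULift.ext _ _ ?_
        let l : ULift.{u} ℂ →ₗ[ℂ] ℂ := f.1
        show l ((((χ⁻¹ : G →* ℂˣ) g⁻¹ : ℂˣ) : ℂ) • ULift.up (1 : ℂ)) =
          ((χ g : ℂˣ) : ℂ) • l (ULift.up 1)
        rw [map_smul, MonoidHom.inv_apply, map_inv, inv_inv] })
  hom_inv_id := by
    apply ObjectProperty.hom_ext
    refine Rep.hom_ext (Representation.IntertwiningMap.ext (LinearMap.ext fun z => ?_))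
    refine ULift.ext _ _ ?_
    exact mul_one z.down
  inv_hom_id := by
    apply ObjectProperty.hom_ext
    refine Rep.hom_ext (Representation.IntertwiningMap.ext (LinearMap.ext fun f => ?_))
    refine Subtype.ext (LinearMap.ext fun w => ?_)
    let l : ULift.{u} ℂ →ₗ[ℂ] ℂ := f.1
    let z : ULift.{u} ℂ := w
    show l (ULift.up 1) * z.down = l z
    rw [mul_comm, ← smul_eq_mul, ← map_smul]
    exact congrArg l (ULift.ext _ _ (mul_one _))

lemma subsingleton_ext_of_iso {C : Type*} [Category* C] [Abelian C] [HasExt.{u} C] {X Y Y' : C}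
    (e : Y ≅ Y') {n : ℕ} (h : Subsingleton (Abelian.Ext.{u} X Y n)) :
    Subsingleton (Abelian.Ext.{u} X Y' n) := by
  refine subsingleton_of_forall_eq 0 fun x => ?_
  have h1 : (x.comp (Abelian.Ext.mk₀ e.inv) (add_zero n)).comp (Abelian.Ext.mk₀ e.hom)
      (add_zero n) = x := by
    simp
  rw [← h1, Subsingleton.elim (x.comp (Abelian.Ext.mk₀ e.inv) (add_zero n)) 0,
    Abelian.Ext.zero_comp]

end Character

end LSheaf

/-! ### The main theorem -/

theorem mainTheorem5 {G X Y : Type u}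
    [Group G] [TopologicalSpace G] [IsTopologicalGroup G] [LSheaf.IsLSpace G]
    [TopologicalSpace X] [LSheaf.IsLSpace X] [MulAction G X] [ContinuousSMul G X]
    [TopologicalSpace Y] [LSheaf.IsLSpace Y]
    (F : LSheaf.LSh X) (α : LSheaf.EquivariantStructure G F)
    (π : X → Y) (hπ : Continuous π) (hinv : ∀ (g : G) (x : X), π (g • x) = π x) :
    (∀ (V₁ V₂ : LSheaf.SmoothRep G) (i : ℤ),
      (∀ y : Y, Subsingleton
        (LSheaf.extG ((α.fiberSections hinv y).tensor V₁) V₂.contragredient i)) →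
      Subsingleton (LSheaf.extG (α.sections.tensor V₁) V₂.contragredient i)) ∧
    (∀ (χ : G →* ℂˣ) (hχ : IsLocallyConstant χ) (k : ℕ) (i : ℤ),
      (∀ y : Y, Subsingleton
        (LSheaf.genExt k (α.fiberSections hinv y) (LSheaf.SmoothRep.ofChar χ hχ) i)) →
      Subsingleton (LSheaf.genExt k α.sections (LSheaf.SmoothRep.ofChar χ hχ) i)) := by
  refine ⟨fun V₁ V₂ i h => ?_, fun χ hχ k i h => ?_⟩
  · cases i with
    | ofNat n => exact LSheaf.subsingleton_ext_sections α hπ hinv V₂ n V₁ h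
    | negSucc n => exact inferInstanceAs (Subsingleton PUnit)
  · cases i with
    | ofNat n =>
      obtain ⟨K, hK, hK'⟩ := LSheaf.exists_isCompact_isOpen_subgroup (G := G)
      -- The fiberwise criterion is applied with second factor the truncated quotient of `ℂ[G/K]`,
      -- the same for every fiber, and with target `χ` written as the contragredient of `χ⁻¹`.
      have hχ' : IsLocallyConstant (χ⁻¹ : G →* ℂˣ) := hχ.inv
      let e := LSheaf.ofCharIsoContragredient χ hχ hχ'
      refine (LSheaf.subsingleton_genExt_iff hK hK' k α.sections _ n).2
        (LSheaf.subsingleton_ext_of_iso e.symm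
          (LSheaf.subsingleton_ext_sections α hπ hinv _ n _ fun y => ?_))
      exact LSheaf.subsingleton_ext_of_iso e
        ((LSheaf.subsingleton_genExt_iff hK hK' k (α.fiberSections hinv y) _ n).1 (h y))
    | negSucc n => exact inferInstanceAs (Subsingleton PUnit)
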